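/- Let $\mathbb{C}^+=\{z:\operatorname{Im}z>0\}$ and let $H^2(\mathbb{C}^+)$ be the Hardy space of holomorphic $F$ on $\mathbb{C}^+$ with $\|F\|^2=\sup_{y>0}\int_{\mathbb{R}}|F(x+iy)|^2\,dx<\infty$. Let $K(z,w)=\frac{i}{2\pi}\frac{1}{z-\bar w}$ be its Szegő kernel. Let $z_1,\dots,z_N\in\mathbb{C}^+$, let $A_1,\dots,A_N\in\mathbb{R}$ and $\lambda_1,\dots,\lambda_N>0$. For $\lambda>0$ define kernels by $K^{(0)}_\lambda=\frac1\lambda K$ and, for $1\le n\le N$, $$K^{(n)}_\lambda(z,w)=K^{(n-1)}_\lambda(z,w)-\frac{\lambda_n\operatorname{Re}K^{(n-1)}_\lambda(z_n,w)\,\operatorname{Re}K^{(n-1)}_\lambda(z,z_n)}{\lambda_n\operatorname{Re}K^{(n-1)}_\lambda(z_n,z_n)+1}.$$ Let $S^{(n)}$ be the $N\times N$ matrix that differs from the identity only in column $n$, with $$S^{(n)}_{in}=\delta_{in}-\frac{\lambda_n\operatorname{Re}K^{(n-1)}_\lambda(z_n,z_i)}{\lambda_n\operatorname{Re}K^{(n-1)}_\lambda(z_n,z_n)+1}.$$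 Put $(c_1,\dots,c_N)=(\lambda_1A_1,\dots,\lambda_NA_N)\,S^{(N)}\cdots S^{(1)}\,\frac1\lambda$ and $$F_{\{A_j,z_j\},\lambda}(z)=\sum_{j=1}^N c_j\operatorname{Re}K(z,z_j),\qquad z\in\mathbb{C}^+.$$ 1. For every $\lambda>0$ one has $F_{\{A_j,z_j\},\lambda}(z)=\sum_{j=1}^N A_j\lambda_j\operatorname{Re}K^{(N)}_\lambda(z,z_j)$ for $z\in\mathbb{C}^+$. The functional $$F\mapsto\lambda\|F\|^2+\sum_{j=1}^N\lambda_j|\operatorname{Re}F(z_j)-A_j|^2$$ has exactly one minimizer in $H^2(\mathbb{C}^+)$, namely $F_\lambda=\sum_{j=1}^N c_jK(\cdot,z_j)$, and $F_{\{A_j,z_j\},\lambda}=\operatorname{Re}F_\lambda$. 2. There is exactly one Moore–Penrose generalized-inverse solution $F^*\in H^2(\mathbb{C}^+)$ of the equations $\operatorname{Re}F(z_j)=A_j$ $(1\le j\le N)$, that is, an element of smallest norm among the minimizers of $\sum_{j}\lambda_j|\operatorname{Re}F(z_j)-A_j|^2$ over $H^2(\mathbb{C}^+)$. As $\lambda\to0^+$,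 $F_\lambda\to F^*$ in $H^2(\mathbb{C}^+)$, and $F_{\{A_j,z_j\},\lambda}(z)\to\operatorname{Re}F^*(z)$ for every $z\in\mathbb{C}^+$, uniformly on each $E_0\subseteq\mathbb{C}^+$ with $\sup_{p\in E_0}K(p,p)<\infty$. The function $u=\operatorname{Re}F^*$ is harmonic on $\mathbb{C}^+$. If the data are consistent ($A_i=A_j$ whenever $z_i=z_j$; in particular if the points are distinct), then $u(z_j)=A_j$ for $j=1,\dots,N$. -/

import Mathlib

open Filter Topology MeasureTheory
open scoped UpperHalfPlane ENNReal Matrix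

noncomputable section

namespace HardyDirichlet

/-- The (extended) Hardy norm of a function on the upper half-plane:
`sup_{y > 0} (∫_ℝ |F(x + iy)|² dx)^{1/2}`. -/
def hardyENorm (F : ℍ → ℂ) : ℝ≥0∞ :=
  ⨆ y : {y : ℝ // 0 < y}, eLpNorm (fun x : ℝ => F ⟨⟨x, y.1⟩, y.2⟩) 2 volume

/-- Membership in the Hardy space `H²(ℂ⁺)`: holomorphic on the upper half-plane,
with finite Hardy norm. -/
def MemHardy (F : ℍ → ℂ) : Prop :=
  DifferentiableOn ℂ (fun w : ℂ => F (UpperHalfPlane.ofComplex w)) {w : ℂ | 0 < w.im} ∧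
    hardyENorm F < ∞

/-- The norm of `H²(ℂ⁺)`. -/
def hardyNorm (F : ℍ → ℂ) : ℝ := (hardyENorm F).toReal

/-- The Szegő kernel `K(z, w) = (i / 2π) · 1 / (z - conj w)` of the upper half-plane. -/
def szego (z w : ℍ) : ℂ :=
  Complex.I / (2 * (Real.pi : ℂ)) * (1 / ((z : ℂ) - (starRingEnd ℂ) (w : ℂ)))

/-- The rank-one update of a kernel when the point `p` is added with weight `l`:
`k(z, w) - l Re k(p, w) Re k(z, p) / (l Re k(p, p) + 1)`. -/
def kernelUpdate (k : ℍ → ℍ → ℂ) (p : ℍ) (l : ℝ) (z w : ℍ) : ℂ :=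
  k z w - ((l * (k p w).re * (k z p).re / (l * (k p p).re + 1) : ℝ) : ℂ)

/-- The iterated kernels `K_lam^{(n)}`, `n = 0, …, N`: start from `K / lam` and add the points
`z_1, …, z_N` one after the other. -/
def iterKernel {N : ℕ} (z : Fin N → ℍ) (l : Fin N → ℝ) (lam : ℝ) :
    Fin (N + 1) → ℍ → ℍ → ℂ :=
  Fin.induction (motive := fun _ => ℍ → ℍ → ℂ) (fun p q => ((1 / lam : ℝ) : ℂ) * szego p q)
    (fun n k => kernelUpdate k (z n) (l n))

/-- The matrix `I - [0 | aᵀ | 0]`, with `aᵀ` in column `n` and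
`a_i = l_n Re k(z_n, z_i) / (l_n Re k(z_n, z_n) + 1)`, that takes the vector of the `Re k(·, z_i)`
to the vector of the real parts of the kernel updated at `z_n`. -/
def stepMatrix {N : ℕ} (z : Fin N → ℍ) (l : Fin N → ℝ) (k : ℍ → ℍ → ℂ) (n : Fin N) :
    Matrix (Fin N) (Fin N) ℝ :=
  1 - Matrix.of fun i m =>
    if m = n then l n * (k (z n) (z i)).re / (l n * (k (z n) (z n)).re + 1) else 0

/-- The products `A^{(n)} ⋯ A^{(1)}`, `n = 0, …, N`; the factor `1 / lam` of the first step is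
the value at `n = 0`. -/
def coefMatrix {N : ℕ} (z : Fin N → ℍ) (l : Fin N → ℝ) (lam : ℝ) :
    Fin (N + 1) → Matrix (Fin N) (Fin N) ℝ :=
  Fin.induction (motive := fun _ => Matrix (Fin N) (Fin N) ℝ) ((1 / lam) • 1)
    (fun n M => stepMatrix z l (iterKernel z l lam n.castSucc) n * M)

/-- The coefficients `c = (l_1 A_1, …, l_N A_N) (A^{(N)} ⋯ A^{(1)})`. -/
def coef {N : ℕ} (z : Fin N → ℍ) (A l : Fin N → ℝ) (lam : ℝ) : Fin N → ℝ :=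
  (fun j => l j * A j) ᵥ* coefMatrix z l lam (Fin.last N)

/-- The function `F_{{A_j, z_j}, lam}(w) = ∑ c_j Re K(w, z_j)` given by the algorithm. -/
def approxSolution {N : ℕ} (z : Fin N → ℍ) (A l : Fin N → ℝ) (lam : ℝ) (w : ℍ) : ℝ :=
  ∑ j, coef z A l lam j * (szego w (z j)).re

/-- The holomorphic function `∑ c_j K(w, z_j)` with the same coefficients. -/
def approxAnalytic {N : ℕ} (z : Fin N → ℍ) (A l : Fin N → ℝ) (lam : ℝ) (w : ℍ) : ℂ :=
  ∑ j, (coef z A l lam j : ℂ) * szego w (z j)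

/-- The weighted discrete residual `∑ l_j |Re F(z_j) - A_j|²`. -/
def residual {N : ℕ} (z : Fin N → ℍ) (A l : Fin N → ℝ) (F : ℍ → ℂ) : ℝ :=
  ∑ j, l j * |(F (z j)).re - A j| ^ 2

/-- The Tikhonov functional `lam ‖F‖² + ∑ l_j |Re F(z_j) - A_j|²`. -/
def tikhonov {N : ℕ} (z : Fin N → ℍ) (A l : Fin N → ℝ) (lam : ℝ) (F : ℍ → ℂ) : ℝ :=
  lam * hardyNorm F ^ 2 + residual z A l F

/-- `F` solves the Tikhonov-regularized extremal problem in `H²(ℂ⁺)`. -/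
def IsExtremal {N : ℕ} (z : Fin N → ℍ) (A l : Fin N → ℝ) (lam : ℝ) (F : ℍ → ℂ) : Prop :=
  MemHardy F ∧ ∀ G, MemHardy G → tikhonov z A l lam F ≤ tikhonov z A l lam G

/-- `F` is a least-squares solution in `H²(ℂ⁺)` of `Re F(z_j) = A_j`. -/
def IsLeastSquares {N : ℕ} (z : Fin N → ℍ) (A l : Fin N → ℝ) (F : ℍ → ℂ) : Prop :=
  MemHardy F ∧ ∀ G, MemHardy G → residual z A l F ≤ residual z A l G

/-- `F` is the Moore–Penrose generalized-inverse solution of `Re F(z_j) = A_j`: a least-squares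
solution of minimal norm among all of them. -/
def IsMoorePenrose {N : ℕ} (z : Fin N → ℍ) (A l : Fin N → ℝ) (F : ℍ → ℂ) : Prop :=
  IsLeastSquares z A l F ∧ ∀ G, IsLeastSquares z A l G → hardyNorm F ≤ hardyNorm G

end HardyDirichlet

end

noncomputable section

namespace HardyDirichlet

/-! Over the real scalars, H² carries the inner product Re⟨F, G⟩, and `F ↦ Re F(z_j)` is represented
by K(·, z_j). Everything about minimizers follows from one identity, the reproducing property in the
form of an expansion of `‖F + cK(·, w)‖²` (`MemHardy.hardyNorm_add_smul_szego`). No Hilbert space or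
boundary values are constructed: the L² norms on horizontal lines decrease with height
(`HardyStrip.eLpNorm_le`), so the supremum defining the norm is a limit as y → 0⁺. On each line the
cross term is computed by Cauchy's formula (`HardyStrip.cauchy_upper`).

The algorithm is a chain of rank-one updates. The invariant `lam_mul_coefMatrix` describes the
matrix product after each step; at the last step it yields the normal equations λc_m = λ_m(A_m −
u(z_m)), u being the computed function (`lam_mul_coef`). These cancel the linear terms when the
Tikhonov functional is expanded about `∑ c_j K(·, z_j)`, so this function is the unique minimizer.

For the limit, coinciding points are merged: weights add and data are replaced by weighted means.
Least-squares solutions are exactly the interpolants of the means, and the one in the span of the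
kernels is orthogonal to every difference of two of them, hence has least norm. The merged
coefficients solve (λW⁻¹ + G)C = a, with G the Gram matrix at distinct points. Since G is
invertible, C converges as λ → 0⁺, and all the convergence statements follow from this
finite-dimensional one. -/

/-! ### Contour shifts for functions with bounded L² norms on horizontal lines. -/

/-- A function that is holomorphic on a neighbourhood of the closed upper half-plane and whose
squared `L²` norms on the lines `Im = t`, `0 ≤ t`, are bounded by `M`. -/
structure HardyStrip (a : ℝ) (f : ℂ → ℂ) (M : ℝ) : Prop where
  neg : a < 0
  diff : DifferentiableOn ℂ f {w : ℂ | a < w.im}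
  integrable_sq : ∀ t : ℝ, 0 ≤ t → Integrable (fun x : ℝ => ‖f (x + t * Complex.I)‖ ^ 2)
  integral_sq_le : ∀ t : ℝ, 0 ≤ t → ∫ x : ℝ, ‖f (x + t * Complex.I)‖ ^ 2 ≤ M

lemma continuousOn_line {a : ℝ} {f : ℂ → ℂ} (hf : DifferentiableOn ℂ f {w : ℂ | a < w.im})
    {t : ℝ} (ht : a < t) : Continuous (fun x : ℝ => f (x + t * Complex.I)) := by
  refine hf.continuousOn.comp_continuous (by fun_prop) fun x => ?_
  simpa using ht

/-- An integrable majorant cannot stay above a positive constant on a ray. This replaces pointwise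
decay in the contour argument: the vertical sides are only known to be integrable in their abscissa.
-/
lemma eq_zero_of_tendsto_of_norm_le_integrable {u : ℝ → ℂ} {L : ℂ} {g : ℝ → ℝ}
    (hu : Tendsto u atTop (𝓝 L)) (hg : Integrable g) (hle : ∀ᶠ R in atTop, ‖u R‖ ≤ g R) :
    L = 0 := by
  by_contra hL
  have hpos : 0 < ‖L‖ / 2 := by positivity
  have h1 : ∀ᶠ R in atTop, ‖L‖ / 2 < ‖u R‖ :=
    hu.norm.eventually_const_lt (by linarith)
  obtain ⟨R, hR⟩ := eventually_atTop.1 (h1.and hle)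
  have h2 : IntegrableOn (fun _ : ℝ => ‖L‖ / 2) (Set.Ici R) := by
    refine Integrable.mono' hg.integrableOn aestronglyMeasurable_const ?_
    filter_upwards [ae_restrict_mem measurableSet_Ici] with x hx
    rw [Real.norm_of_nonneg hpos.le]
    exact (hR x hx).1.le.trans (hR x hx).2
  rw [integrableOn_const_iff] at h2
  simp [hpos.ne'] at h2

/-- Cauchy's theorem on [−R, R] × [0, T]. The horizontal sides converge, so the vertical
contribution has a limit; by Fubini it is dominated by an integrable function of R, so that limit is
zero. -/
lemma integral_line_eq_of_integrable {a : ℝ} {h : ℂ → ℂ}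
    (hh : DifferentiableOn ℂ h {w : ℂ | a < w.im}) (ha : a < 0) {T : ℝ} (hT : 0 ≤ T)
    (h0 : Integrable (fun x : ℝ => h x)) (h1 : Integrable (fun x : ℝ => h (x + T * Complex.I)))
    {g : ℝ → ℝ → ℝ} (hg : Integrable (Function.uncurry g) (volume.prod (volume.restrict (Set.Ioc 0 T))))
    (hgi : ∀ x, IntegrableOn (g x) (Set.Ioc 0 T))
    {R₀ : ℝ} (hle : ∀ x t : ℝ, R₀ ≤ |x| → t ∈ Set.Ioc 0 T → ‖h (x + t * Complex.I)‖ ≤ g x t) :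
    ∫ x : ℝ, h x = ∫ x : ℝ, h (x + T * Complex.I) := by
  set φ : ℝ → ℝ := fun x => ∫ t in Set.Ioc 0 T, g x t with hφ
  have hφi : Integrable φ := hg.integral_prod_left
  set V : ℝ → ℂ := fun x => ∫ t in (0 : ℝ)..T, h (x + t * Complex.I) with hV
  have hVle : ∀ x, R₀ ≤ |x| → ‖V x‖ ≤ φ x := by
    intro x hx
    rw [hV, hφ]
    simp only
    rw [intervalIntegral.integral_of_le hT]
    refine norm_integral_le_of_norm_le (hgi x) ?_
    filter_upwards [ae_restrict_mem measurableSet_Ioc] with t ht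
    exact hle x t hx ht
  have hrect : ∀ R : ℝ, 0 ≤ R → Complex.I * (V R - V (-R)) =
      (∫ x in (-R)..R, h (x + T * Complex.I)) - ∫ x in (-R)..R, h x := by
    intro R hR
    have := Complex.integral_boundary_rect_eq_zero_of_differentiableOn h ((-R : ℝ) : ℂ)
      (R + T * Complex.I) (hh.mono ?_)
    · simp at this
      simp only [hV, Complex.ofReal_neg]
      linear_combination this
    · intro w hw
      have := hw.2
      simp [Set.uIcc_of_le hT] at this
      exact ha.trans_le this.1
  have hlim : Tendsto (fun R : ℝ => Complex.I * (V R - V (-R))) atTop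
      (𝓝 ((∫ x : ℝ, h (x + T * Complex.I)) - ∫ x : ℝ, h x)) := by
    have e1 := intervalIntegral_tendsto_integral h1 tendsto_neg_atTop_atBot tendsto_id
    have e0 := intervalIntegral_tendsto_integral h0 tendsto_neg_atTop_atBot tendsto_id
    refine (e1.sub e0).congr' ?_
    filter_upwards [eventually_ge_atTop 0] with R hR
    exact (hrect R hR).symm
  have := eq_zero_of_tendsto_of_norm_le_integrable hlim (hφi.add hφi.comp_neg) ?_
  · exact (sub_eq_zero.1 this).symm
  · filter_upwards [eventually_ge_atTop 0, eventually_ge_atTop R₀] with R hR hR'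
    rw [norm_mul, Complex.norm_I, one_mul]
    refine (norm_sub_le _ _).trans (add_le_add (hVle R ?_) (hVle (-R) ?_))
    · rwa [abs_of_nonneg hR]
    · rwa [abs_neg, abs_of_nonneg hR]

lemma integral_inv_sq_add_sq (a : ℝ) {b : ℝ} (hb : 0 < b) :
    ∫ x : ℝ, ((x - a) ^ 2 + b ^ 2)⁻¹ = Real.pi / b := by
  have := ProbabilityTheory.integral_cauchyPDFReal_eq_one a (γ := ⟨b, hb.le⟩)
    (fun h => hb.ne' (congrArg NNReal.toReal h))
  unfold ProbabilityTheory.cauchyPDFReal at this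
  rw [integral_const_mul] at this
  change Real.pi⁻¹ * b * (∫ x : ℝ, ((x - a) ^ 2 + b ^ 2)⁻¹) = 1 at this
  have hp := Real.pi_pos
  field_simp at this ⊢
  linarith

lemma integrable_inv_sq_add_sq (a : ℝ) {b : ℝ} (hb : 0 < b) :
    Integrable fun x : ℝ => ((x - a) ^ 2 + b ^ 2)⁻¹ := by
  apply Integrable.of_integral_ne_zero
  rw [integral_inv_sq_add_sq a hb]
  positivity

lemma norm_inv_sub_sq (x t : ℝ) (c : ℂ) :
    ‖((x : ℂ) + t * Complex.I - c)⁻¹‖ ^ 2 = ((x - c.re) ^ 2 + (t - c.im) ^ 2)⁻¹ := by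
  rw [norm_inv, inv_pow, ← Complex.normSq_eq_norm_sq, Complex.normSq_apply]
  simp [sq]

lemma HardyStrip.integrable_prod {a : ℝ} {f : ℂ → ℂ} {M : ℝ} (hf : HardyStrip a f M) (T : ℝ) :
    Integrable (fun p : ℝ × ℝ => ‖f (p.1 + p.2 * Complex.I)‖ ^ 2)
      (volume.prod (volume.restrict (Set.Ioc 0 T))) := by
  have hm : AEStronglyMeasurable (fun p : ℝ × ℝ => ‖f (p.1 + p.2 * Complex.I)‖ ^ 2)
      (volume.prod (volume.restrict (Set.Ioc 0 T))) := by
    have : (volume : Measure ℝ).prod (volume.restrict (Set.Ioc 0 T)) =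
        (volume.prod volume).restrict (Set.univ ×ˢ Set.Ioc 0 T) := by
      rw [← Measure.prod_restrict, Measure.restrict_univ]
    rw [this]
    refine ContinuousOn.aestronglyMeasurable ?_ (MeasurableSet.univ.prod measurableSet_Ioc)
    refine (ContinuousOn.norm ?_).pow 2
    refine hf.diff.continuousOn.comp (by fun_prop) ?_
    intro p hp
    simpa using hf.neg.trans hp.2.1
  rw [integrable_prod_iff' hm]
  constructor
  · filter_upwards [ae_restrict_mem measurableSet_Ioc] with t ht
    exact hf.integrable_sq t ht.1.le
  · refine Integrable.mono' (integrable_const M) hm.norm.prod_swap.integral_prod_right' ?_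
    filter_upwards [ae_restrict_mem measurableSet_Ioc] with t ht
    rw [Real.norm_of_nonneg (integral_nonneg fun _ => norm_nonneg _)]
    simpa using hf.integral_sq_le t ht.1.le

lemma norm_mul_le_add_sq (u v : ℂ) : ‖u * v‖ ≤ ‖u‖ ^ 2 + ‖v‖ ^ 2 := by
  rw [norm_mul]
  nlinarith [sq_nonneg (‖u‖ - ‖v‖), sq_nonneg ‖u‖, sq_nonneg ‖v‖]

section Quotient

variable {a : ℝ} {f h : ℂ → ℂ} {M : ℝ} {c : ℂ}

lemma quotient_eq {t : ℝ} (hfh : ∀ w : ℂ, 0 ≤ w.im → h w * (w - c) = f w) (ht : 0 ≤ t) {x : ℝ}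
    (hne : (x : ℂ) + t * Complex.I ≠ c) :
    h (x + t * Complex.I) = f (x + t * Complex.I) * ((x : ℂ) + t * Complex.I - c)⁻¹ := by
  rw [← hfh _ (by simpa using ht), mul_inv_cancel_right₀ (sub_ne_zero.2 hne)]

lemma integrable_quotient (hf : HardyStrip a f M) (hh : DifferentiableOn ℂ h {w : ℂ | a < w.im})
    (hfh : ∀ w : ℂ, 0 ≤ w.im → h w * (w - c) = f w) {t : ℝ} (ht : 0 ≤ t) (htc : t ≠ c.im) :
    Integrable (fun x : ℝ => h (x + t * Complex.I)) := by
  have h2 := integrable_inv_sq_add_sq c.re (abs_pos.2 (sub_ne_zero.2 htc))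
  refine Integrable.mono' ((hf.integrable_sq t ht).add h2)
    (continuousOn_line hh (hf.neg.trans_le ht)).aestronglyMeasurable (ae_of_all _ fun x => ?_)
  rw [quotient_eq hfh ht]
  · refine (norm_mul_le_add_sq _ _).trans_eq ?_
    rw [norm_inv_sub_sq]
    simp
  · intro e
    apply htc
    simpa using congrArg Complex.im e

/-- Here `h` is f/(w − c), with any singularity at `c` already removed. The line of integration
moves up to height T, where the integral is O((T − Im c)^(−1/2)). -/
lemma integral_quotient_eq_zero (hf : HardyStrip a f M)
    (hh : DifferentiableOn ℂ h {w : ℂ | a < w.im})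
    (hfh : ∀ w : ℂ, 0 ≤ w.im → h w * (w - c) = f w) (hc : c.im ≠ 0) :
    ∫ x : ℝ, h x = 0 := by
  have h0 : Integrable (fun x : ℝ => h x) := by
    simpa using integrable_quotient hf hh hfh le_rfl hc.symm
  have hshift : ∀ T : ℝ, 0 ≤ T → c.im < T → ∫ x : ℝ, h x = ∫ x : ℝ, h (x + T * Complex.I) := by
    intro T hT hcT
    have hk := (integrable_inv_sq_add_sq c.re one_pos)
    refine integral_line_eq_of_integrable hh hf.neg hT h0
      (integrable_quotient hf hh hfh hT hcT.ne')
      (g := fun x t => ‖f (x + t * Complex.I)‖ ^ 2 + ((x - c.re) ^ 2 + 1 ^ 2)⁻¹)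
      -- For |x| ≥ |Re c| + 1 the distance from x to Re c is at least 1, so |w − c|⁻² is at most
      -- 2/((x − Re c)² + 1) at every height, including that of `c`.
      (((hf.integrable_prod T).add (hk.comp_fst _)).congr (ae_of_all _ fun _ => rfl)) ?_ (R₀ := |c.re| + 1) ?_
    · intro x
      refine Integrable.add (ContinuousOn.integrableOn_Icc ?_ |>.mono_set Set.Ioc_subset_Icc_self)
        (integrable_const _)
      refine (ContinuousOn.norm ?_).pow 2
      refine hf.diff.continuousOn.comp (by fun_prop) ?_
      intro t ht
      simpa using hf.neg.trans_le ht.1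
    · intro x t hx ht
      have hx1 : 1 ≤ |x - c.re| := by
        have := abs_sub_abs_le_abs_sub x c.re
        linarith
      have hx2 : 1 ≤ (x - c.re) ^ 2 := by
        rw [← sq_abs]; nlinarith
      rw [quotient_eq hfh ht.1.le]
      · rw [norm_mul]
        have e := norm_inv_sub_sq x t c
        have : ((x - c.re) ^ 2 + (t - c.im) ^ 2)⁻¹ ≤ 2 * ((x - c.re) ^ 2 + 1 ^ 2)⁻¹ := by
          rw [← div_eq_mul_inv, inv_eq_one_div, div_le_div_iff₀ (by positivity) (by positivity)]
          nlinarith [sq_nonneg (t - c.im)]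
        rw [← e] at this
        nlinarith [sq_nonneg (‖f (x + t * Complex.I)‖ - ‖((x : ℂ) + t * Complex.I - c)⁻¹‖),
          sq_nonneg ‖f (x + t * Complex.I)‖]
      · intro e
        have := congrArg Complex.re e
        simp at this
        simp [this] at hx1
        linarith
  have hbound : ∀ T : ℝ, 0 ≤ T → c.im < T →
      ‖∫ x : ℝ, h x‖ ≤ (M + Real.pi) * (Real.sqrt (T - c.im))⁻¹ := by
    intro T hT hcT
    rw [hshift T hT hcT]
    have hd : 0 < T - c.im := sub_pos.2 hcT
    -- The weight in uv ≤ s⁻¹u² + sv². The integral of v² is π/s², so both terms become multiples of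
    -- s⁻¹.
    set s := Real.sqrt (T - c.im) with hs
    have hspos : 0 < s := Real.sqrt_pos.2 hd
    have hss : s ^ 2 = T - c.im := Real.sq_sqrt hd.le
    have hi := integrable_inv_sq_add_sq c.re hd
    have : ‖∫ x : ℝ, h (x + T * Complex.I)‖ ≤
        ∫ x : ℝ, (s⁻¹ * ‖f (x + T * Complex.I)‖ ^ 2 + s * ((x - c.re) ^ 2 + (T - c.im) ^ 2)⁻¹) := by
      refine norm_integral_le_of_norm_le
        (((hf.integrable_sq T hT).const_mul _).add (hi.const_mul _)) (ae_of_all _ fun x => ?_)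
      rw [quotient_eq hfh hT]
      · rw [norm_mul, ← norm_inv_sub_sq]
        set u := ‖f (x + T * Complex.I)‖
        set v := ‖((x : ℂ) + T * Complex.I - c)⁻¹‖
        have hv : 0 ≤ v := norm_nonneg _
        have hu : 0 ≤ u := norm_nonneg _
        have : 0 ≤ s⁻¹ * (u - s * v) ^ 2 := by positivity
        have e : s⁻¹ * (u - s * v) ^ 2 = s⁻¹ * u ^ 2 + s * v ^ 2 - 2 * (u * v) := by
          field_simp
          ring
        nlinarith [mul_nonneg hu hv]
      · intro e
        apply hcT.ne'
        simpa using congrArg Complex.im e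
    rw [integral_add ((hf.integrable_sq T hT).const_mul _) (hi.const_mul _), integral_const_mul,
      integral_const_mul, integral_inv_sq_add_sq _ hd] at this
    refine this.trans ?_
    have hM := hf.integral_sq_le T hT
    rw [← hss]
    have : s * (Real.pi / s ^ 2) = Real.pi * s⁻¹ := by field_simp
    rw [this, add_mul, mul_comm s⁻¹]
    gcongr
  have hlim : Tendsto (fun T : ℝ => (M + Real.pi) * (Real.sqrt (T - c.im))⁻¹) atTop (𝓝 0) := by
    rw [← mul_zero (M + Real.pi)]
    refine (tendsto_inv_atTop_zero.comp ?_).const_mul _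
    exact Real.tendsto_sqrt_atTop.comp (tendsto_atTop_add_const_right _ _ tendsto_id)
  have := ge_of_tendsto hlim (b := ‖∫ x : ℝ, h x‖) ?_
  · simpa using this
  · filter_upwards [eventually_ge_atTop 0, eventually_gt_atTop c.im] with T hT hcT
    exact hbound T hT hcT

end Quotient

/-! ### Cauchy and Poisson formulas on the real line. -/

lemma HardyStrip.cauchy_lower {a : ℝ} {f : ℂ → ℂ} {M : ℝ} (hf : HardyStrip a f M) {c : ℂ}
    (hc : c.im < 0) : ∫ x : ℝ, f x * ((x : ℂ) - c)⁻¹ = 0 := by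
  have hne : ∀ w : ℂ, max a c.im < w.im → w - c ≠ 0 := by
    intro w hw e
    have := (le_max_right a c.im).trans_lt hw
    rw [sub_eq_zero.1 e] at this
    exact lt_irrefl _ this
  have hf' : HardyStrip (max a c.im) f M :=
    ⟨max_lt hf.neg hc, hf.diff.mono fun w hw => (le_max_left a c.im).trans_lt hw,
      hf.integrable_sq, hf.integral_sq_le⟩
  refine integral_quotient_eq_zero (h := fun w => f w * (w - c)⁻¹) hf' ?_ ?_ hc.ne
  · refine hf'.diff.mul (DifferentiableOn.inv (by fun_prop) fun w hw => hne w hw)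
  · intro w hw
    exact inv_mul_cancel_right₀ (hne w (hf'.neg.trans_le hw)) _

lemma integral_sq_cauchy {c : ℂ} {t : ℝ} (h : 0 < t - c.im) :
    Integrable (fun x : ℝ => ‖((x : ℂ) + t * Complex.I - c)⁻¹‖ ^ 2) ∧
      ∫ x : ℝ, ‖((x : ℂ) + t * Complex.I - c)⁻¹‖ ^ 2 = Real.pi / (t - c.im) := by
  simp_rw [norm_inv_sub_sq]
  exact ⟨integrable_inv_sq_add_sq _ h, integral_inv_sq_add_sq _ h⟩

lemma inv_sub_mul_inv_sub_conj (x : ℝ) (c : ℂ) :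
    ((x : ℂ) - (starRingEnd ℂ) c)⁻¹ * ((x : ℂ) - c)⁻¹ =
      (((x - c.re) ^ 2 + c.im ^ 2)⁻¹ : ℝ) := by
  rw [← mul_inv, Complex.ofReal_inv]
  congr 1
  apply Complex.ext
  · simp [sq]
  · simp [sq]; ring

lemma sub_conj_eq (c : ℂ) : c - (starRingEnd ℂ) c = 2 * c.im * Complex.I := by
  rw [Complex.sub_conj]; push_cast; ring

lemma HardyStrip.integrable_mul_inv {a : ℝ} {f : ℂ → ℂ} {M : ℝ} (hf : HardyStrip a f M) {c : ℂ}
    (hc : c.im ≠ 0) : Integrable fun x : ℝ => f x * ((x : ℂ) - c)⁻¹ := by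
  have h2 := integrable_inv_sq_add_sq c.re (abs_pos.2 hc)
  have h1 := hf.integrable_sq 0 le_rfl
  have hcont := continuousOn_line hf.diff hf.neg
  simp only [Complex.ofReal_zero, zero_mul, add_zero] at h1 hcont
  refine Integrable.mono' (h1.add h2) ?_ (ae_of_all _ fun x => ?_)
  · refine (hcont.mul (Continuous.inv₀ (by fun_prop) fun x e => hc ?_)).aestronglyMeasurable
    simpa using (congrArg Complex.im (sub_eq_zero.1 e)).symm
  · refine (norm_mul_le_add_sq _ _).trans_eq ?_
    have := norm_inv_sub_sq x 0 c
    simp only [Complex.ofReal_zero, zero_mul, add_zero] at this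
    rw [this]
    simp

/-- Subtracting a multiple of 1/(w − c̄) makes the function vanish at `c` and keeps it in the class,
so its quotient by w − c integrates to zero. The subtracted term contributes the explicit Cauchy
integral f(c)(c − c̄)π/Im c. -/
lemma HardyStrip.cauchy_upper {a : ℝ} {f : ℂ → ℂ} {M : ℝ} (hf : HardyStrip a f M) {c : ℂ}
    (hc : 0 < c.im) : ∫ x : ℝ, f x * ((x : ℂ) - c)⁻¹ = 2 * Real.pi * Complex.I * f c := by
  set q := (starRingEnd ℂ) c with hq
  have hqim : q.im = -c.im := by simp [hq]
  set d := f c * (c - q) with hd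
  set b := max a q.im with hb
  have hb0 : b < 0 := max_lt hf.neg (by linarith)
  have hne : ∀ w : ℂ, b < w.im → w - q ≠ 0 := by
    intro w hw e
    have := (le_max_right a q.im).trans_lt hw
    rw [sub_eq_zero.1 e] at this
    exact lt_irrefl _ this
  have hcq : c - q ≠ 0 := hne c (hb0.trans hc)
  set g : ℂ → ℂ := fun w => f w - d * (w - q)⁻¹ with hg
  have hk : ∀ t : ℝ, 0 ≤ t → Integrable (fun x : ℝ => ‖((x : ℂ) + t * Complex.I - q)⁻¹‖ ^ 2) ∧
      ∫ x : ℝ, ‖((x : ℂ) + t * Complex.I - q)⁻¹‖ ^ 2 ≤ Real.pi / c.im := by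
    intro t ht
    have := integral_sq_cauchy (c := q) (t := t) (by linarith)
    refine ⟨this.1, this.2.trans_le ?_⟩
    have := Real.pi_pos
    gcongr
    linarith
  have hgdiff : DifferentiableOn ℂ g {w : ℂ | b < w.im} :=
    (hf.diff.mono fun w hw => (le_max_left a q.im).trans_lt hw).sub
      ((DifferentiableOn.inv (by fun_prop) fun w hw => hne w hw).const_mul d)
  have hgle : ∀ w, ‖g w‖ ^ 2 ≤ 2 * ‖f w‖ ^ 2 + 2 * ‖d‖ ^ 2 * ‖(w - q)⁻¹‖ ^ 2 := by
    intro w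
    have h1 := norm_sub_le (f w) (d * (w - q)⁻¹)
    rw [norm_mul d] at h1
    have h2 : ‖g w‖ ^ 2 ≤ (‖f w‖ + ‖d‖ * ‖(w - q)⁻¹‖) ^ 2 := by gcongr
    nlinarith [sq_nonneg (‖f w‖ - ‖d‖ * ‖(w - q)⁻¹‖)]
  have hgi : ∀ t : ℝ, 0 ≤ t → Integrable (fun x : ℝ => ‖g (x + t * Complex.I)‖ ^ 2) := by
    intro t ht
    refine Integrable.mono' (((hf.integrable_sq t ht).const_mul 2).add
      ((hk t ht).1.const_mul (2 * ‖d‖ ^ 2)))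
      ((continuousOn_line hgdiff (hb0.trans_le ht)).norm.pow 2).aestronglyMeasurable
      (ae_of_all _ fun x => ?_)
    rw [Real.norm_of_nonneg (by positivity)]
    exact hgle _
  have hgs : HardyStrip b g (2 * M + 2 * ‖d‖ ^ 2 * (Real.pi / c.im)) := by
    refine ⟨hb0, hgdiff, hgi, fun t ht => ?_⟩
    refine (integral_mono (hgi t ht) (((hf.integrable_sq t ht).const_mul 2).add
      ((hk t ht).1.const_mul (2 * ‖d‖ ^ 2))) fun x => hgle _).trans ?_
    simp only [Pi.add_apply]
    rw [integral_add ((hf.integrable_sq t ht).const_mul 2)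
      ((hk t ht).1.const_mul (2 * ‖d‖ ^ 2)), integral_const_mul, integral_const_mul]
    have h1 := hf.integral_sq_le t ht
    have h2 := (hk t ht).2
    gcongr
  have hgc : g c = 0 := by
    simp only [hg, hd]
    rw [mul_inv_cancel_right₀ hcq, sub_self]
  have hmem : {w : ℂ | b < w.im} ∈ 𝓝 c :=
    (isOpen_lt continuous_const Complex.continuous_im).mem_nhds (hb0.trans hc)
  -- `dslope g c` is g/(w − c) with the removable singularity filled in.
  have hzero := integral_quotient_eq_zero (h := dslope g c) hgs
    ((Complex.differentiableOn_dslope hmem).2 hgdiff) (fun w _ => by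
      have := sub_smul_dslope g c w
      rw [hgc, sub_zero, smul_eq_mul] at this
      rw [mul_comm, this]) hc.ne'
  have hxc : ∀ x : ℝ, (x : ℂ) ≠ c := by
    intro x e
    exact hc.ne (by simpa using congrArg Complex.im e)
  have hint := integrable_inv_sq_add_sq c.re hc
  have heq : ∀ x : ℝ, dslope g c x = f x * ((x : ℂ) - c)⁻¹ -
      d * (((x - c.re) ^ 2 + c.im ^ 2)⁻¹ : ℝ) := by
    intro x
    rw [dslope_of_ne _ (hxc x), slope_def_field, hgc, ← inv_sub_mul_inv_sub_conj]
    simp only [hg]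
    rw [← hq]
    ring
  simp_rw [heq] at hzero
  have hint' : Integrable fun x : ℝ => d * (((x - c.re) ^ 2 + c.im ^ 2)⁻¹ : ℝ) :=
    hint.ofReal.const_mul d
  rw [integral_sub (hf.integrable_mul_inv hc.ne') hint', integral_const_mul,
    integral_complex_ofReal, integral_inv_sq_add_sq _ hc, sub_eq_zero] at hzero
  rw [hzero, hd, hq, sub_conj_eq]
  have : (c.im : ℂ) ≠ 0 := by exact_mod_cast hc.ne'
  push_cast
  field_simp

/-- The Poisson formula. -/
lemma HardyStrip.poisson {a : ℝ} {f : ℂ → ℂ} {M : ℝ} (hf : HardyStrip a f M) {c : ℂ}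
    (hc : 0 < c.im) :
    f c = ∫ x : ℝ, ((Real.pi⁻¹ * c.im * ((x - c.re) ^ 2 + c.im ^ 2)⁻¹ : ℝ) : ℂ) * f x := by
  have hq : ((starRingEnd ℂ) c).im < 0 := by simpa using hc
  have h1 := hf.cauchy_upper hc
  have h2 := hf.cauchy_lower hq
  have h3 : ∀ x : ℝ, ((Real.pi⁻¹ * c.im * ((x - c.re) ^ 2 + c.im ^ 2)⁻¹ : ℝ) : ℂ) * f x =
      (2 * Real.pi * Complex.I)⁻¹ *
        (f x * ((x : ℂ) - c)⁻¹ - f x * ((x : ℂ) - (starRingEnd ℂ) c)⁻¹) := by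
    intro x
    have hxc : (x : ℂ) - c ≠ 0 := by
      intro e
      exact hc.ne (by simpa using congrArg Complex.im (sub_eq_zero.1 e))
    have hxq : (x : ℂ) - (starRingEnd ℂ) c ≠ 0 := by
      intro e
      exact hq.ne' (by simpa using congrArg Complex.im (sub_eq_zero.1 e))
    rw [Complex.ofReal_mul, ← inv_sub_mul_inv_sub_conj]
    have : ((x : ℂ) - c)⁻¹ - ((x : ℂ) - (starRingEnd ℂ) c)⁻¹ =
        (c - (starRingEnd ℂ) c) * (((x : ℂ) - (starRingEnd ℂ) c)⁻¹ * ((x : ℂ) - c)⁻¹) := by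
      field_simp
      ring
    rw [← mul_sub, this, sub_conj_eq]
    have hpi : (Real.pi : ℂ) ≠ 0 := by exact_mod_cast Real.pi_ne_zero
    have hI := Complex.I_ne_zero
    push_cast
    field_simp
  simp_rw [h3]
  rw [integral_const_mul, integral_sub (hf.integrable_mul_inv hc.ne')
    (hf.integrable_mul_inv hq.ne), h1, h2, sub_zero, inv_mul_cancel_left₀]
  have hpi : (Real.pi : ℂ) ≠ 0 := by exact_mod_cast Real.pi_ne_zero
  simp [hpi]

/-! ### Monotonicity of the L² norm in the height. -/

lemma eLpNorm_two_sq {μ : Measure ℝ} (g : ℝ → ℂ) :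
    eLpNorm g 2 μ ^ 2 = ∫⁻ x, ‖g x‖ₑ ^ 2 ∂μ := by
  have := eLpNorm_nnreal_pow_eq_lintegral (μ := μ) (f := g) (p := 2) two_ne_zero
  simpa using this

lemma eLpNorm_two_sq_eq_ofReal {g : ℝ → ℂ} (hi : Integrable fun x => ‖g x‖ ^ 2) :
    eLpNorm g 2 volume ^ 2 = ENNReal.ofReal (∫ x, ‖g x‖ ^ 2) := by
  rw [eLpNorm_two_sq, ofReal_integral_eq_lintegral_ofReal hi (ae_of_all _ fun _ => sq_nonneg _)]
  congr 1 with x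
  rw [ENNReal.ofReal_pow (norm_nonneg _), ofReal_norm]

lemma lintegral_cauchyPDF_left (γ : NNReal) (hγ : γ ≠ 0) (s : ℝ) :
    ∫⁻ x : ℝ, ProbabilityTheory.cauchyPDF x γ s = 1 := by
  rw [← ProbabilityTheory.lintegral_cauchyPDF_eq_one s hγ]
  congr 1 with x
  rw [ProbabilityTheory.cauchyPDF_def, ProbabilityTheory.cauchyPDF_def,
    ProbabilityTheory.cauchyPDFReal_def, ProbabilityTheory.cauchyPDFReal_def]
  congr 3
  ring

/-- The Poisson kernel is the density of a Cauchy distribution, and on a probability space the L¹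
norm is at most the L² norm. -/
lemma HardyStrip.enorm_sq_le {a : ℝ} {f : ℂ → ℂ} {M : ℝ} (hf : HardyStrip a f M) (x : ℝ)
    (γ : NNReal) (hγ : γ ≠ 0) :
    ‖f (x + (γ : ℝ) * Complex.I)‖ₑ ^ 2 ≤
      ∫⁻ s : ℝ, ProbabilityTheory.cauchyPDF x γ s * ‖f s‖ₑ ^ 2 := by
  set μ := ProbabilityTheory.cauchyMeasure x γ with hμ
  have hμe : μ = volume.withDensity (ProbabilityTheory.cauchyPDF x γ) :=
    ProbabilityTheory.cauchyMeasure_of_scale_ne_zero x hγ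
  have hcont : Continuous fun s : ℝ => f s := by
    simpa using continuousOn_line hf.diff hf.neg
  have hrep : f (x + (γ : ℝ) * Complex.I) = ∫ s : ℝ, f s ∂μ := by
    rw [hf.poisson (c := x + (γ : ℝ) * Complex.I) (by simpa using pos_iff_ne_zero.2 hγ), hμe,
      integral_withDensity_eq_integral_toReal_smul (ProbabilityTheory.measurable_cauchyPDF x γ)
        (ae_of_all _ fun s => ENNReal.ofReal_lt_top)]
    congr 1 with s
    rw [ProbabilityTheory.cauchyPDF_def,
      ENNReal.toReal_ofReal (ProbabilityTheory.cauchyPDF_pos x hγ s).le,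
      ProbabilityTheory.cauchyPDFReal_def, Complex.real_smul]
    simp
  calc ‖f (x + (γ : ℝ) * Complex.I)‖ₑ ^ 2
      ≤ (∫⁻ s : ℝ, ‖f s‖ₑ ∂μ) ^ 2 := by
        rw [hrep]; gcongr; exact enorm_integral_le_lintegral_enorm _
    _ = eLpNorm (fun s : ℝ => f s) 1 μ ^ 2 := by rw [eLpNorm_one_eq_lintegral_enorm]
    _ ≤ eLpNorm (fun s : ℝ => f s) 2 μ ^ 2 := by
        gcongr
        exact eLpNorm_le_eLpNorm_of_exponent_le one_le_two hcont.aestronglyMeasurable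
    _ = _ := by
        rw [eLpNorm_two_sq, hμe, lintegral_withDensity_eq_lintegral_mul _ (by fun_prop)
          (hcont.measurable.enorm.pow_const 2)]
        rfl

/-- The previous bound is integrated in x with Tonelli; the Cauchy density has total mass one in its
location parameter as well. -/
lemma HardyStrip.eLpNorm_le {a : ℝ} {f : ℂ → ℂ} {M : ℝ} (hf : HardyStrip a f M) {t : ℝ}
    (ht : 0 < t) : eLpNorm (fun x : ℝ => f (x + t * Complex.I)) 2 volume ≤
      eLpNorm (fun x : ℝ => f x) 2 volume := by
  have hcont : Continuous fun s : ℝ => f s := by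
    simpa using continuousOn_line hf.diff hf.neg
  have hmeas : Measurable fun s : ℝ => ‖f s‖ₑ ^ 2 := hcont.measurable.enorm.pow_const 2
  lift t to NNReal using ht.le
  have hγ : t ≠ 0 := by
    rintro rfl
    simp at ht
  rw [← ENNReal.pow_le_pow_left_iff two_ne_zero, eLpNorm_two_sq, eLpNorm_two_sq]
  calc ∫⁻ x : ℝ, ‖f (x + (t : ℝ) * Complex.I)‖ₑ ^ 2
      ≤ ∫⁻ x : ℝ, ∫⁻ s : ℝ, ProbabilityTheory.cauchyPDF x t s * ‖f s‖ₑ ^ 2 :=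
        lintegral_mono fun x => hf.enorm_sq_le x t hγ
    _ = ∫⁻ s : ℝ, ∫⁻ x : ℝ, ProbabilityTheory.cauchyPDF x t s * ‖f s‖ₑ ^ 2 := by
        refine lintegral_lintegral_swap (Measurable.aemeasurable ?_)
        unfold ProbabilityTheory.cauchyPDF ProbabilityTheory.cauchyPDFReal
        exact Measurable.mul (by fun_prop) (hmeas.comp measurable_snd)
    _ = ∫⁻ s : ℝ, ‖f s‖ₑ ^ 2 := by
        congr 1 with s
        rw [lintegral_mul_const' _ _ (by simp), lintegral_cauchyPDF_left t hγ, one_mul]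

/-! ### The Hardy space of the half-plane. -/

/-- The extension of a function on the upper half-plane to the complex plane. -/
abbrev ext (F : ℍ → ℂ) (w : ℂ) : ℂ := F (UpperHalfPlane.ofComplex w)

lemma ext_line (F : ℍ → ℂ) {y : ℝ} (hy : 0 < y) (x : ℝ) :
    ext F (x + y * Complex.I) = F ⟨⟨x, y⟩, hy⟩ := by
  have : (x + y * Complex.I : ℂ) = ⟨x, y⟩ := by
    apply Complex.ext <;> simp
  unfold ext
  rw [this, UpperHalfPlane.ofComplex_apply_of_im_pos (z := ⟨x, y⟩) hy]

lemma hardyENorm_eq (F : ℍ → ℂ) :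
    hardyENorm F = ⨆ y : {y : ℝ // 0 < y},
      eLpNorm (fun x : ℝ => ext F (x + y.1 * Complex.I)) 2 volume := by
  unfold hardyENorm
  congr 1 with y
  simp_rw [ext_line F y.2]

lemma eLpNorm_line_le (F : ℍ → ℂ) {y : ℝ} (hy : 0 < y) :
    eLpNorm (fun x : ℝ => ext F (x + y * Complex.I)) 2 volume ≤ hardyENorm F := by
  rw [hardyENorm_eq]
  exact le_iSup (fun y : {y : ℝ // 0 < y} =>
    eLpNorm (fun x : ℝ => ext F (x + y.1 * Complex.I)) 2 volume) ⟨y, hy⟩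

section MemHardy

variable {F G : ℍ → ℂ}

lemma MemHardy.continuous_line (hF : MemHardy F) {y : ℝ} (hy : 0 < y) :
    Continuous (fun x : ℝ => ext F (x + y * Complex.I)) :=
  continuousOn_line hF.1 hy

lemma MemHardy.memLp_line (hF : MemHardy F) {y : ℝ} (hy : 0 < y) :
    MemLp (fun x : ℝ => ext F (x + y * Complex.I)) 2 volume :=
  ⟨(hF.continuous_line hy).aestronglyMeasurable, (eLpNorm_line_le F hy).trans_lt hF.2⟩

lemma MemHardy.integrable_sq (hF : MemHardy F) {y : ℝ} (hy : 0 < y) :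
    Integrable (fun x : ℝ => ‖ext F (x + y * Complex.I)‖ ^ 2) :=
  (memLp_two_iff_integrable_sq_norm (hF.continuous_line hy).aestronglyMeasurable).1
    (hF.memLp_line hy)

lemma MemHardy.integral_sq_eq (hF : MemHardy F) {y : ℝ} (hy : 0 < y) :
    ∫ x : ℝ, ‖ext F (x + y * Complex.I)‖ ^ 2 =
      (eLpNorm (fun x : ℝ => ext F (x + y * Complex.I)) 2 volume).toReal ^ 2 := by
  rw [← ENNReal.toReal_pow, eLpNorm_two_sq_eq_ofReal (hF.integrable_sq hy),
    ENNReal.toReal_ofReal (integral_nonneg fun _ => sq_nonneg _)]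

lemma MemHardy.integral_sq_le (hF : MemHardy F) {y : ℝ} (hy : 0 < y) :
    ∫ x : ℝ, ‖ext F (x + y * Complex.I)‖ ^ 2 ≤ hardyNorm F ^ 2 := by
  rw [hF.integral_sq_eq hy]
  gcongr
  exact ENNReal.toReal_mono hF.2.ne (eLpNorm_line_le F hy)

lemma MemHardy.hardyStrip (hF : MemHardy F) {y : ℝ} (hy : 0 < y) :
    HardyStrip (-y) (fun w => ext F (w + y * Complex.I)) (hardyNorm F ^ 2) := by
  have e : ∀ x t : ℝ, (x : ℂ) + t * Complex.I + y * Complex.I =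
      x + ((t + y : ℝ) : ℂ) * Complex.I := by
    intro x t; push_cast; ring
  refine ⟨by linarith, ?_, fun t ht => ?_, fun t ht => ?_⟩
  · refine DifferentiableOn.comp (g := ext F) (t := {w : ℂ | 0 < w.im}) hF.1
      (f := fun w => w + y * Complex.I) (by fun_prop) ?_
    intro w hw
    have : -y < w.im := hw
    simp
    linarith
  · simp_rw [e]
    exact hF.integrable_sq (by linarith)
  · simp_rw [e]
    exact hF.integral_sq_le (by linarith)

lemma MemHardy.eLpNorm_antitone (hF : MemHardy F) {y₁ y₂ : ℝ} (hy : 0 < y₁) (h : y₁ < y₂) :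
    eLpNorm (fun x : ℝ => ext F (x + y₂ * Complex.I)) 2 volume ≤
      eLpNorm (fun x : ℝ => ext F (x + y₁ * Complex.I)) 2 volume := by
  have := (hF.hardyStrip hy).eLpNorm_le (sub_pos.2 h)
  convert this using 4 with x
  push_cast
  ring

/-- Monotonicity turns the supremum over heights into a limit, so that identities valid on each line
pass to the norm. -/
lemma MemHardy.tendsto_integral_sq (hF : MemHardy F) :
    Tendsto (fun y : ℝ => ∫ x : ℝ, ‖ext F (x + y * Complex.I)‖ ^ 2) (𝓝[>] 0)
      (𝓝 (hardyNorm F ^ 2)) := by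
  have h1 : Tendsto (fun y : ℝ => eLpNorm (fun x : ℝ => ext F (x + y * Complex.I)) 2 volume)
      (𝓝[>] 0) (𝓝 (hardyENorm F)) := by
    refine tendsto_order.2 ⟨fun b hb => ?_, fun b hb => ?_⟩
    · rw [hardyENorm_eq, lt_iSup_iff] at hb
      obtain ⟨⟨y, hy⟩, hyb⟩ := hb
      filter_upwards [Ioo_mem_nhdsGT hy] with t ht
      exact hyb.trans_le (hF.eLpNorm_antitone ht.1 ht.2)
    · filter_upwards [self_mem_nhdsWithin] with t ht
      exact (eLpNorm_line_le F ht).trans_lt hb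
  refine (((ENNReal.tendsto_toReal hF.2.ne).comp h1).pow 2).congr' ?_
  filter_upwards [self_mem_nhdsWithin] with y hy
  exact (hF.integral_sq_eq hy).symm

lemma MemHardy.add (hF : MemHardy F) (hG : MemHardy G) : MemHardy (F + G) := by
  refine ⟨hF.1.add hG.1, ?_⟩
  refine lt_of_le_of_lt ?_ (ENNReal.add_lt_top.2 ⟨hF.2, hG.2⟩)
  rw [hardyENorm_eq]
  refine iSup_le fun y => ?_
  refine (eLpNorm_add_le (hF.continuous_line y.2).aestronglyMeasurable
    (hG.continuous_line y.2).aestronglyMeasurable one_le_two).trans ?_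
  exact add_le_add (eLpNorm_line_le F y.2) (eLpNorm_line_le G y.2)

lemma MemHardy.const_smul (hF : MemHardy F) (c : ℂ) : MemHardy (c • F) := by
  refine ⟨DifferentiableOn.const_smul hF.1 c, ?_⟩
  refine lt_of_le_of_lt ?_ (ENNReal.mul_lt_top (enorm_lt_top (x := c)) hF.2)
  rw [hardyENorm_eq]
  refine iSup_le fun y => ?_
  refine (eLpNorm_const_smul_le (c := c)).trans ?_
  gcongr
  exact eLpNorm_line_le F y.2

lemma MemHardy.zero : MemHardy 0 :=
  ⟨differentiableOn_const _, by simp [hardyENorm]⟩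

lemma MemHardy.sub (hF : MemHardy F) (hG : MemHardy G) : MemHardy (F - G) := by
  have := hF.add (hG.const_smul (-1))
  rwa [neg_one_smul, ← sub_eq_add_neg] at this

lemma MemHardy.sum {ι : Type*} {f : ι → ℍ → ℂ} (hf : ∀ i, MemHardy (f i)) (s : Finset ι) :
    MemHardy (∑ i ∈ s, f i) :=
  Finset.sum_induction _ MemHardy (fun _ _ => MemHardy.add) MemHardy.zero fun i _ => hf i

end MemHardy

/-! ### The Szegő kernel and its reproducing property. -/

lemma szego_eq (z w : ℍ) :
    szego z w = Complex.I / (2 * Real.pi) * ((z : ℂ) - (starRingEnd ℂ) (w : ℂ))⁻¹ := by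
  rw [szego, one_div]

lemma sub_conj_ne_zero {z : ℂ} (hz : 0 < z.im) (w : ℍ) : z - (starRingEnd ℂ) (w : ℂ) ≠ 0 := by
  intro e
  have h := congrArg Complex.im (sub_eq_zero.1 e)
  have := w.im_pos
  rw [Complex.conj_im, UpperHalfPlane.coe_im] at h
  linarith

lemma ext_szego (w : ℍ) {v : ℂ} (hv : 0 < v.im) :
    ext (fun v => szego v w) v = Complex.I / (2 * Real.pi) * (v - (starRingEnd ℂ) (w : ℂ))⁻¹ := by
  change szego (UpperHalfPlane.ofComplex v) w = _
  rw [szego_eq, UpperHalfPlane.ofComplex_apply_of_im_pos hv]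

lemma norm_szego_const : ‖Complex.I / (2 * Real.pi)‖ ^ 2 = (4 * Real.pi ^ 2)⁻¹ := by
  simp [mul_pow, abs_of_pos Real.pi_pos]
  norm_num

lemma szego_line (w : ℍ) {y : ℝ} (hy : 0 < y) :
    Integrable (fun x : ℝ => ‖ext (fun v => szego v w) (x + y * Complex.I)‖ ^ 2) ∧
    ∫ x : ℝ, ‖ext (fun v => szego v w) (x + y * Complex.I)‖ ^ 2 =
      (4 * Real.pi * (y + w.im))⁻¹ := by
  have hd : 0 < y - ((starRingEnd ℂ) (w : ℂ)).im := by
    have := w.im_pos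
    rw [Complex.conj_im, UpperHalfPlane.coe_im]
    linarith
  have h : ∀ x : ℝ, ‖ext (fun v => szego v w) (x + y * Complex.I)‖ ^ 2 =
      (4 * Real.pi ^ 2)⁻¹ * ‖((x : ℂ) + y * Complex.I - (starRingEnd ℂ) (w : ℂ))⁻¹‖ ^ 2 := by
    intro x
    rw [ext_szego w (by simpa using hy), norm_mul, mul_pow, norm_szego_const]
  obtain ⟨h1, h2⟩ := integral_sq_cauchy hd
  simp_rw [h]
  refine ⟨h1.const_mul _, ?_⟩
  rw [integral_const_mul, h2, Complex.conj_im, UpperHalfPlane.coe_im, sub_neg_eq_add]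
  have := Real.pi_ne_zero
  have hne : y + w.im ≠ 0 := by have := w.im_pos; positivity
  field_simp

lemma szego_self_re (w : ℍ) : (szego w w).re = (4 * Real.pi * w.im)⁻¹ := by
  have h : szego w w = ((4 * Real.pi * w.im)⁻¹ : ℝ) := by
    rw [szego_eq, sub_conj_eq, UpperHalfPlane.coe_im]
    have h1 : (Real.pi : ℂ) ≠ 0 := by exact_mod_cast Real.pi_ne_zero
    have h2 : (w.im : ℂ) ≠ 0 := by exact_mod_cast w.im_pos.ne'
    have := Complex.I_ne_zero
    push_cast
    field_simp
    norm_num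
  rw [h, Complex.ofReal_re]

lemma szego_symm (z w : ℍ) : szego z w = (starRingEnd ℂ) (szego w z) := by
  rw [szego_eq, szego_eq]
  simp only [map_mul, map_inv₀, map_sub, map_div₀, Complex.conj_I, Complex.conj_ofReal,
    Complex.conj_conj, map_ofNat]
  rw [← neg_sub ((z : ℂ)), inv_neg, neg_div]
  ring

lemma szego_re_symm (z w : ℍ) : (szego z w).re = (szego w z).re := by
  rw [szego_symm, Complex.conj_re]

lemma memHardy_szego (w : ℍ) : MemHardy fun v => szego v w := by
  constructor
  · refine DifferentiableOn.congr (f := fun v : ℂ => Complex.I / (2 * Real.pi) *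
      (v - (starRingEnd ℂ) (w : ℂ))⁻¹) ?_ fun v hv => ext_szego w hv
    exact (DifferentiableOn.inv (by fun_prop) fun v hv => sub_conj_ne_zero hv w).const_mul _
  · rw [hardyENorm_eq]
    refine lt_of_le_of_lt (b := ENNReal.ofReal (Real.sqrt (4 * Real.pi * w.im)⁻¹))
      (iSup_le fun y => ?_) ENNReal.ofReal_lt_top
    rw [← ENNReal.pow_le_pow_left_iff two_ne_zero, eLpNorm_two_sq_eq_ofReal (szego_line w y.2).1,
      (szego_line w y.2).2]
    have hw := w.im_pos
    have hp := Real.pi_pos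
    rw [← ENNReal.ofReal_pow (Real.sqrt_nonneg _), Real.sq_sqrt (by positivity)]
    apply ENNReal.ofReal_le_ofReal
    gcongr
    linarith [y.2]

/-- On the line at height y the conjugate kernel is a Cauchy kernel with pole at w + iy for the
shifted function F(· + iy). Pole and shift each contribute y, hence the point w + 2iy. -/
lemma MemHardy.integral_mul_conj_szego {F : ℍ → ℂ} (hF : MemHardy F) (w : ℍ) {y : ℝ} (hy : 0 < y) :
    Integrable (fun x : ℝ => ext F (x + y * Complex.I) *
      (starRingEnd ℂ) (ext (fun v => szego v w) (x + y * Complex.I))) ∧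
    ∫ x : ℝ, ext F (x + y * Complex.I) *
      (starRingEnd ℂ) (ext (fun v => szego v w) (x + y * Complex.I)) =
      ext F (w + (2 * y : ℝ) * Complex.I) := by
  have hc : 0 < ((w : ℂ) + y * Complex.I).im := by
    have := w.im_pos
    simp
    linarith
  have hpi : (Real.pi : ℂ) ≠ 0 := by exact_mod_cast Real.pi_ne_zero
  have hI := Complex.I_ne_zero
  have h : ∀ x : ℝ, ext F (x + y * Complex.I) *
      (starRingEnd ℂ) (ext (fun v => szego v w) (x + y * Complex.I)) =
      (2 * Real.pi * Complex.I)⁻¹ *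
        (ext F (x + y * Complex.I) * ((x : ℂ) - (w + y * Complex.I))⁻¹) := by
    intro x
    rw [ext_szego w (by simpa using hy)]
    simp only [map_mul, map_inv₀, map_sub, map_div₀, Complex.conj_I, Complex.conj_ofReal,
      Complex.conj_conj, map_ofNat, map_add]
    have e1 : (x : ℂ) + y * -Complex.I - w = x - (w + y * Complex.I) := by ring
    have e2 : -Complex.I / (2 * Real.pi) = (2 * Real.pi * Complex.I)⁻¹ := by
      field_simp
      rw [Complex.I_sq]
      norm_num
    rw [e1, e2]
    ring
  simp_rw [h]
  refine ⟨((hF.hardyStrip hy).integrable_mul_inv hc.ne').const_mul _, ?_⟩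
  rw [integral_const_mul, (hF.hardyStrip hy).cauchy_upper hc, inv_mul_cancel_left₀ (by simp [hpi])]
  congr 1
  push_cast
  ring

/-- The reproducing property of the Szegő kernel, in polarized form. -/
theorem MemHardy.hardyNorm_add_smul_szego {F : ℍ → ℂ} (hF : MemHardy F) (w : ℍ) (c : ℝ) :
    hardyNorm (F + (c : ℂ) • fun v => szego v w) ^ 2 =
      hardyNorm F ^ 2 + 2 * c * (F w).re + c ^ 2 * (szego w w).re := by
  set K : ℍ → ℂ := fun v => szego v w with hK
  have hG : MemHardy (F + (c : ℂ) • K) := hF.add ((memHardy_szego w).const_smul c)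
  have hline : ∀ y : ℝ, 0 < y → ∫ x : ℝ, ‖ext (F + (c : ℂ) • K) (x + y * Complex.I)‖ ^ 2 =
      (∫ x : ℝ, ‖ext F (x + y * Complex.I)‖ ^ 2) +
        2 * c * (ext F (w + (2 * y : ℝ) * Complex.I)).re + c ^ 2 * (4 * Real.pi * (y + w.im))⁻¹ := by
    intro y hy
    obtain ⟨i1, e1⟩ := hF.integral_mul_conj_szego w hy
    obtain ⟨i2, e2⟩ := szego_line w hy
    have hpt : ∀ x : ℝ, ‖ext (F + (c : ℂ) • K) (x + y * Complex.I)‖ ^ 2 =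
        ‖ext F (x + y * Complex.I)‖ ^ 2 + 2 * c * (ext F (x + y * Complex.I) *
          (starRingEnd ℂ) (ext K (x + y * Complex.I))).re +
          c ^ 2 * ‖ext K (x + y * Complex.I)‖ ^ 2 := by
      intro x
      have : ext (F + (c : ℂ) • K) (x + y * Complex.I) =
        ext F (x + y * Complex.I) + c * ext K (x + y * Complex.I) := rfl
      rw [this, ← Complex.normSq_eq_norm_sq, ← Complex.normSq_eq_norm_sq,
        ← Complex.normSq_eq_norm_sq, Complex.normSq_add, Complex.normSq_mul, Complex.normSq_ofReal,
        map_mul, Complex.conj_ofReal, mul_left_comm, Complex.re_ofReal_mul]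
      ring
    have i1' : Integrable fun x : ℝ => 2 * c * (ext F (x + y * Complex.I) *
          (starRingEnd ℂ) (ext K (x + y * Complex.I))).re := i1.re.const_mul _
    have i2' := i2.const_mul (c ^ 2)
    simp_rw [hpt]
    have i12 : Integrable fun x : ℝ => ‖ext F (x + y * Complex.I)‖ ^ 2 +
        2 * c * (ext F (x + y * Complex.I) * (starRingEnd ℂ) (ext K (x + y * Complex.I))).re :=
      (hF.integrable_sq hy).add i1'
    rw [integral_add i12 i2', integral_add (hF.integrable_sq hy) i1',
      integral_const_mul, integral_const_mul, e2, ← e1]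
    congr 3
    exact integral_re i1
  have hF2 : Tendsto (fun y : ℝ => (ext F (w + (2 * y : ℝ) * Complex.I)).re) (𝓝[>] 0)
      (𝓝 (F w).re) := by
    have hcont : ContinuousAt (ext F) w :=
      (hF.1.differentiableAt ((isOpen_lt continuous_const Complex.continuous_im).mem_nhds
        w.im_pos)).continuousAt
    have h0 : Tendsto (fun y : ℝ => (w : ℂ) + (2 * y : ℝ) * Complex.I) (𝓝[>] 0) (𝓝 (w : ℂ)) := by
      have : Continuous fun y : ℝ => (w : ℂ) + (2 * y : ℝ) * Complex.I := by fun_prop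
      simpa using (this.tendsto 0).mono_left nhdsWithin_le_nhds
    have := (Complex.continuous_re.tendsto _).comp (hcont.tendsto.comp h0)
    simpa [ext, Function.comp_def, UpperHalfPlane.ofComplex_apply] using this
  have hK2 : Tendsto (fun y : ℝ => (4 * Real.pi * (y + w.im))⁻¹) (𝓝[>] 0) (𝓝 (szego w w).re) := by
    have hne : 4 * Real.pi * (0 + w.im) ≠ 0 := by
      have := w.im_pos
      have := Real.pi_pos
      positivity
    have : ContinuousAt (fun y : ℝ => (4 * Real.pi * (y + w.im))⁻¹) 0 :=
      ContinuousAt.inv₀ (by fun_prop) hne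
    rw [szego_self_re]
    simpa [ContinuousAt] using this.tendsto.mono_left nhdsWithin_le_nhds
  refine tendsto_nhds_unique hG.tendsto_integral_sq ?_
  refine ((hF.tendsto_integral_sq.add (hF2.const_mul (2 * c))).add (hK2.const_mul (c ^ 2))).congr' ?_
  filter_upwards [self_mem_nhdsWithin] with y hy
  exact (hline y hy).symm

/-! ### Norms of kernel combinations. -/

section Combination

variable {ι : Type*}

lemma hardyNorm_zero : hardyNorm 0 = 0 := by
  simp [hardyNorm, hardyENorm]

lemma MemHardy.eq_zero_of_hardyNorm_eq_zero {F : ℍ → ℂ} (hF : MemHardy F) (h : hardyNorm F = 0) :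
    F = 0 := by
  have h0 : hardyENorm F = 0 := ((ENNReal.toReal_eq_zero_iff _).1 h).resolve_right hF.2.ne
  funext w
  have hw := w.im_pos
  have h1 : eLpNorm (fun x : ℝ => ext F (x + w.im * Complex.I)) 2 volume = 0 :=
    le_antisymm ((eLpNorm_line_le F hw).trans_eq h0) zero_le
  have hc := hF.continuous_line hw
  rw [eLpNorm_eq_zero_iff hc.aestronglyMeasurable two_ne_zero] at h1
  have h2 := (hc.ae_eq_iff_eq volume continuous_const).1 h1
  have h3 := congrFun h2 w.re
  have e : ((w.re : ℂ) + w.im * Complex.I) = w := Complex.re_add_im (w : ℂ)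
  simp only [ext, e, UpperHalfPlane.ofComplex_apply] at h3
  exact h3

lemma MemHardy.hardyNorm_add_sum {F : ℍ → ℂ} (hF : MemHardy F) (p : ι → ℍ) (c : ι → ℝ)
    (s : Finset ι) :
    hardyNorm (F + ∑ i ∈ s, (c i : ℂ) • fun v => szego v (p i)) ^ 2 =
      hardyNorm F ^ 2 + 2 * ∑ i ∈ s, c i * (F (p i)).re +
        ∑ i ∈ s, ∑ j ∈ s, c i * c j * (szego (p i) (p j)).re := by
  classical
  induction s using Finset.induction_on with
  | empty => simp
  | insert a s ha ih =>
    have hs : MemHardy (F + ∑ i ∈ s, (c i : ℂ) • fun v => szego v (p i)) :=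
      hF.add (MemHardy.sum (fun i => (memHardy_szego (p i)).const_smul _) s)
    rw [Finset.sum_insert ha, add_comm (_ • _), ← add_assoc, hs.hardyNorm_add_smul_szego, ih,
      Finset.sum_insert ha, Finset.sum_insert ha, Finset.sum_insert ha]
    simp_rw [Finset.sum_insert ha]
    have e1 : ((F + ∑ i ∈ s, (c i : ℂ) • fun v => szego v (p i)) (p a)).re =
        (F (p a)).re + ∑ j ∈ s, c j * (szego (p a) (p j)).re := by
      simp [Finset.sum_apply]
    have e2 : ∑ x ∈ s, (c x * c a * (szego (p x) (p a)).re +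
        ∑ x_1 ∈ s, c x * c x_1 * (szego (p x) (p x_1)).re) =
        c a * ∑ j ∈ s, c j * (szego (p a) (p j)).re +
          ∑ x ∈ s, ∑ x_1 ∈ s, c x * c x_1 * (szego (p x) (p x_1)).re := by
      rw [Finset.sum_add_distrib, Finset.mul_sum]
      congr 1
      refine Finset.sum_congr rfl fun x _ => ?_
      rw [szego_re_symm (p x)]
      ring
    have e3 : ∑ x ∈ s, c a * c x * (szego (p a) (p x)).re =
        c a * ∑ j ∈ s, c j * (szego (p a) (p j)).re := by
      rw [Finset.mul_sum]
      exact Finset.sum_congr rfl fun x _ => by ring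
    rw [e1, e2, e3]
    ring

variable [Fintype ι]

/-- The combination `∑ c_i K(·, p_i)` of Szegő kernels with real coefficients. -/
def kernelSum (p : ι → ℍ) (c : ι → ℝ) : ℍ → ℂ :=
  ∑ i, (c i : ℂ) • fun v => szego v (p i)

lemma kernelSum_apply (p : ι → ℍ) (c : ι → ℝ) (w : ℍ) :
    kernelSum p c w = ∑ i, (c i : ℂ) * szego w (p i) := by
  simp [kernelSum, Finset.sum_apply]

lemma kernelSum_re (p : ι → ℍ) (c : ι → ℝ) (w : ℍ) :
    (kernelSum p c w).re = ∑ i, c i * (szego w (p i)).re := by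
  simp [kernelSum_apply]

lemma memHardy_kernelSum (p : ι → ℍ) (c : ι → ℝ) : MemHardy (kernelSum p c) :=
  MemHardy.sum (fun i => (memHardy_szego (p i)).const_smul _) _

lemma hardyNorm_kernelSum (p : ι → ℍ) (c : ι → ℝ) :
    hardyNorm (kernelSum p c) ^ 2 = ∑ i, ∑ j, c i * c j * (szego (p i) (p j)).re := by
  have := MemHardy.zero.hardyNorm_add_sum p c Finset.univ
  rw [zero_add, hardyNorm_zero] at this
  rw [kernelSum, this]
  simp

/-- The substitute for an inner product: if Re F vanishes at the points, it is Pythagoras' theorem.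
-/
lemma MemHardy.hardyNorm_add_kernelSum {F : ℍ → ℂ} (hF : MemHardy F) (p : ι → ℍ) (c : ι → ℝ) :
    hardyNorm (F + kernelSum p c) ^ 2 = hardyNorm F ^ 2 + 2 * ∑ i, c i * (F (p i)).re +
      hardyNorm (kernelSum p c) ^ 2 := by
  rw [hardyNorm_kernelSum]
  exact hF.hardyNorm_add_sum p c Finset.univ

lemma kernelSum_sub (p : ι → ℍ) (c d : ι → ℝ) :
    kernelSum p c - kernelSum p d = kernelSum p (c - d) := by
  funext w
  simp [kernelSum_apply, sub_mul]

/-- Positivity of the two-point quadratic form with coefficients 1 and ±1. It explains why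
boundedness of K(p, p) is enough for uniform convergence. -/
lemma abs_szego_re_le (w s : ℍ) : |(szego w s).re| ≤ (szego w w).re + (szego s s).re := by
  have h : ∀ e : ℝ, 0 ≤ (szego w w).re + 2 * e * (szego w s).re + e ^ 2 * (szego s s).re := by
    intro e
    have h1 := hardyNorm_kernelSum ![w, s] ![1, e]
    have h2 := sq_nonneg (hardyNorm (kernelSum ![w, s] ![1, e]))
    rw [h1] at h2
    simp [Fin.sum_univ_two] at h2
    rw [szego_re_symm s w] at h2
    linarith
  have h1 := h 1
  have h2 := h (-1)
  have h3 := h 0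
  rw [abs_le]
  have h4 : 0 ≤ (szego w w).re := by linarith
  have h5 : 0 ≤ (szego s s).re := by
    rw [szego_self_re]
    have := s.im_pos
    have := Real.pi_pos
    positivity
  constructor <;> linarith

end Combination

/-! ### Positivity under rank-one updates, which keeps the denominators positive. -/

/-- Real, symmetric, positive semidefinite kernels. -/
structure IsPosKernel (k : ℍ → ℍ → ℝ) : Prop where
  symm : ∀ p q, k p q = k q p
  nonneg : ∀ (n : ℕ) (x : Fin n → ℝ) (p : Fin n → ℍ), 0 ≤ ∑ i, ∑ j, x i * x j * k (p i) (p j)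

lemma isPosKernel_szego {c : ℝ} (hc : 0 ≤ c) : IsPosKernel fun p q => c * (szego p q).re := by
  refine ⟨fun p q => by rw [szego_re_symm], fun n x p => ?_⟩
  have h : ∑ i, ∑ j, x i * x j * (c * (szego (p i) (p j)).re) =
      c * hardyNorm (kernelSum p x) ^ 2 := by
    rw [hardyNorm_kernelSum, Finset.mul_sum]
    refine Finset.sum_congr rfl fun i _ => ?_
    rw [Finset.mul_sum]
    exact Finset.sum_congr rfl fun j _ => by ring
  rw [h]
  positivity

lemma IsPosKernel.self_nonneg {k : ℍ → ℍ → ℝ} (hk : IsPosKernel k) (p : ℍ) : 0 ≤ k p p := by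
  simpa using hk.nonneg 1 (fun _ => 1) fun _ => p

lemma IsPosKernel.denom_pos {k : ℍ → ℍ → ℝ} (hk : IsPosKernel k) (p : ℍ) {l : ℝ} (hl : 0 < l) :
    0 < l * k p p + 1 := by
  have := hk.self_nonneg p
  positivity

lemma IsPosKernel.update {k : ℍ → ℍ → ℝ} (hk : IsPosKernel k) (q : ℍ) {l : ℝ} (hl : 0 < l) :
    IsPosKernel fun p r => k p r - l * k q r * k p q / (l * k q q + 1) := by
  have hD := hk.denom_pos q hl
  refine ⟨fun p r => ?_, fun n x p => ?_⟩
  · rw [hk.symm p r, hk.symm q r, hk.symm p q]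
    ring
  · set D := l * k q q + 1 with hDdef
    set Q := ∑ i, ∑ j, x i * x j * k (p i) (p j) with hQ
    set B := ∑ i, x i * k (p i) q with hB
    have h1 : ∀ t : ℝ, 0 ≤ Q + 2 * t * B + t ^ 2 * k q q := by
      intro t
      have := hk.nonneg (n + 1) (Fin.cons t x) (Fin.cons q p)
      simp only [Fin.sum_univ_succ, Fin.cons_zero, Fin.cons_succ, Finset.sum_add_distrib] at this
      have e1 : ∑ i, t * x i * k q (p i) = t * B := by
        rw [hB, Finset.mul_sum]
        exact Finset.sum_congr rfl fun i _ => by rw [hk.symm q]; ring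
      have e2 : ∑ i, x i * t * k (p i) q = t * B := by
        rw [hB, Finset.mul_sum]
        exact Finset.sum_congr rfl fun i _ => by ring
      rw [e1, e2, ← hQ] at this
      linarith
    have h2 : ∑ i, ∑ j, x i * x j * (k (p i) (p j) - l * k q (p j) * k (p i) q / D) =
        Q - l * B ^ 2 / D := by
      have : ∀ i j, x i * x j * (k (p i) (p j) - l * k q (p j) * k (p i) q / D) =
          x i * x j * k (p i) (p j) - l / D * ((x i * k (p i) q) * (x j * k (p j) q)) := by
        intro i j
        rw [hk.symm q]
        ring
      simp_rw [this, Finset.sum_sub_distrib, ← Finset.mul_sum, ← Finset.sum_mul]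
      rw [← hQ, ← hB]
      ring
    rw [h2]
    -- The minimizing t would be −B/k(q, q), but k(q, q) may vanish. With D in place of l·k(q, q)
    -- the bound still holds, with lB²/D² to spare.
    have h3 := h1 (-(l * B / D))
    have h4 : Q + 2 * -(l * B / D) * B + (-(l * B / D)) ^ 2 * k q q =
        Q - l * B ^ 2 / D - l * B ^ 2 / D ^ 2 := by
      have : l * k q q = D - 1 := by rw [hDdef]; ring
      field_simp
      linear_combination l * B ^ 2 * this
    have h5 : 0 ≤ l * B ^ 2 / D ^ 2 := by positivity
    linarith

/-! ### The algorithm, its normal equations and the regularized minimizer. -/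

section Iteration

variable {N : ℕ} (z : Fin N → ℍ) (A l : Fin N → ℝ) (lam : ℝ)

lemma iterKernel_zero_re (p q : ℍ) :
    (iterKernel z l lam 0 p q).re = 1 / lam * (szego p q).re := by
  change (((1 / lam : ℝ) : ℂ) * szego p q).re = _
  rw [Complex.re_ofReal_mul]

lemma iterKernel_succ_re (n : Fin N) (p q : ℍ) :
    (iterKernel z l lam n.succ p q).re = (iterKernel z l lam n.castSucc p q).re -
      l n * (iterKernel z l lam n.castSucc (z n) q).re *
        (iterKernel z l lam n.castSucc p (z n)).re /
        (l n * (iterKernel z l lam n.castSucc (z n) (z n)).re + 1) := by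
  have : iterKernel z l lam n.succ = kernelUpdate (iterKernel z l lam n.castSucc) (z n) (l n) :=
    Fin.induction_succ ..
  rw [this, kernelUpdate, Complex.sub_re, Complex.ofReal_re]

lemma coefMatrix_zero : coefMatrix z l lam 0 = (1 / lam) • 1 := rfl

lemma coefMatrix_succ_apply (n i m : Fin N) :
    coefMatrix z l lam n.succ i m = coefMatrix z l lam n.castSucc i m -
      l n * (iterKernel z l lam n.castSucc (z n) (z i)).re /
        (l n * (iterKernel z l lam n.castSucc (z n) (z n)).re + 1) *
        coefMatrix z l lam n.castSucc n m := by
  have : coefMatrix z l lam n.succ =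
      stepMatrix z l (iterKernel z l lam n.castSucc) n * coefMatrix z l lam n.castSucc :=
    Fin.induction_succ ..
  rw [this, stepMatrix, sub_mul, one_mul, Matrix.sub_apply, Matrix.mul_apply]
  simp [ite_mul]

variable {lam}

lemma isPosKernel_iterKernel (hl : ∀ j, 0 < l j) (hlam : 0 < lam) (n : Fin (N + 1)) :
    IsPosKernel fun p q => (iterKernel z l lam n p q).re := by
  induction n using Fin.induction with
  | zero =>
    simp_rw [iterKernel_zero_re]
    exact isPosKernel_szego (by positivity)
  | succ n ih =>
    simp_rw [iterKernel_succ_re]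
    exact ih.update (z n) (hl n)

lemma iterKernel_re_eq_sum (n : Fin (N + 1)) (w : ℍ) (i : Fin N) :
    (iterKernel z l lam n w (z i)).re =
      ∑ m, coefMatrix z l lam n i m * (szego w (z m)).re := by
  induction n using Fin.induction generalizing i with
  | zero =>
    rw [iterKernel_zero_re, coefMatrix_zero]
    simp [Matrix.one_apply]
  | succ n ih =>
    rw [iterKernel_succ_re, ih, ih]
    simp_rw [coefMatrix_succ_apply, sub_mul, Finset.sum_sub_distrib, mul_assoc, ← Finset.mul_sum]
    ring

/-- The invariant of the algorithm: `m.castSucc < n` says that point m has already been added.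
Columns of points not yet added are still those of the identity, and processed columns evolve
exactly as the kernel does. -/
lemma lam_mul_coefMatrix (hl : ∀ j, 0 < l j) (hlam : 0 < lam) (n : Fin (N + 1)) (i m : Fin N) :
    lam * coefMatrix z l lam n i m = (if i = m then 1 else 0) -
      (if m.castSucc < n then l m * (iterKernel z l lam n (z m) (z i)).re else 0) := by
  induction n using Fin.induction generalizing i with
  | zero =>
    rw [coefMatrix_zero]
    simp [Matrix.one_apply, hlam.ne']
  | succ n ih =>
    have hD := ((isPosKernel_iterKernel z l hl hlam n.castSucc).denom_pos (z n) (hl n)).ne'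
    rw [coefMatrix_succ_apply, mul_sub, mul_left_comm, ih, ih, iterKernel_succ_re]
    rcases lt_trichotomy m n with h | h | h
    · have h1 : m.castSucc < n.castSucc := h
      have h2 : m.castSucc < n.succ := Fin.castSucc_lt_succ_iff.2 h.le
      rw [if_pos h1, if_pos h2, if_pos h1, if_neg h.ne']
      ring
    -- The new column: updating at z_n gives K⁽ⁿ⁺¹⁾(z_n, z_i) = K⁽ⁿ⁾(z_n, z_i)/D in real parts,
    -- which is the entry of the step matrix up to the weight.
    · subst h
      rw [if_neg (lt_irrefl _), if_pos (Fin.castSucc_lt_succ), if_neg (lt_irrefl _), if_pos rfl]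
      field_simp
      ring
    · have h1 : ¬ m.castSucc < n.castSucc := not_lt.2 (le_of_lt h)
      have h2 : ¬ m.castSucc < n.succ := fun e => absurd (Fin.castSucc_lt_succ_iff.1 e) (not_le.2 h)
      rw [if_neg h1, if_neg h2, if_neg h1, if_neg h.ne]
      ring

lemma coef_apply (m : Fin N) :
    coef z A l lam m = ∑ i, l i * A i * coefMatrix z l lam (Fin.last N) i m := rfl

lemma approxSolution_eq_sum (w : ℍ) : approxSolution z A l lam w =
    ∑ j, A j * l j * (iterKernel z l lam (Fin.last N) w (z j)).re := by
  unfold approxSolution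
  simp_rw [coef_apply, iterKernel_re_eq_sum, Finset.sum_mul, Finset.mul_sum]
  rw [Finset.sum_comm]
  exact Finset.sum_congr rfl fun i _ => Finset.sum_congr rfl fun j _ => by ring

/-- The normal equations of the Tikhonov functional. -/
lemma lam_mul_coef (hl : ∀ j, 0 < l j) (hlam : 0 < lam) (m : Fin N) :
    lam * coef z A l lam m = l m * (A m - approxSolution z A l lam (z m)) := by
  rw [coef_apply, approxSolution_eq_sum, Finset.mul_sum, mul_sub, Finset.mul_sum]
  have : ∀ i, lam * (l i * A i * coefMatrix z l lam (Fin.last N) i m) =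
      (if i = m then l i * A i else 0) -
        l m * (A i * l i * (iterKernel z l lam (Fin.last N) (z m) (z i)).re) := by
    intro i
    have h := lam_mul_coefMatrix z l hl hlam (Fin.last N) i m
    rw [if_pos (Fin.castSucc_lt_last m)] at h
    rw [mul_left_comm, h]
    split_ifs <;> ring
  simp_rw [this, Finset.sum_sub_distrib]
  simp

lemma approxAnalytic_eq : approxAnalytic z A l lam = kernelSum z (coef z A l lam) := by
  funext w
  rw [kernelSum_apply, approxAnalytic]

lemma kernelSum_coef_re (w : ℍ) :
    (kernelSum z (coef z A l lam) w).re = approxSolution z A l lam w :=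
  kernelSum_re _ _ _

/-- The cross term of the norm, 2λ ∑ c_j Re H(z_j), cancels that of the residual by the normal
equations, leaving an exact quadratic expansion. -/
lemma tikhonov_add (hl : ∀ j, 0 < l j) (hlam : 0 < lam) {H : ℍ → ℂ} (hH : MemHardy H) :
    tikhonov z A l lam (H + kernelSum z (coef z A l lam)) =
      tikhonov z A l lam (kernelSum z (coef z A l lam)) + lam * hardyNorm H ^ 2 +
        ∑ j, l j * (H (z j)).re ^ 2 := by
  unfold tikhonov residual
  rw [hH.hardyNorm_add_kernelSum]
  simp_rw [sq_abs, Pi.add_apply, Complex.add_re, kernelSum_coef_re]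
  have h : ∀ j, l j * ((H (z j)).re + approxSolution z A l lam (z j) - A j) ^ 2 =
      l j * (approxSolution z A l lam (z j) - A j) ^ 2 + l j * (H (z j)).re ^ 2 -
        2 * lam * (coef z A l lam j * (H (z j)).re) := by
    intro j
    linear_combination 2 * (H (z j)).re * lam_mul_coef z A l hl hlam j
  simp_rw [h, Finset.sum_sub_distrib, Finset.sum_add_distrib, ← Finset.mul_sum]
  ring

lemma isExtremal_iff (hl : ∀ j, 0 < l j) (hlam : 0 < lam) (G : ℍ → ℂ) :
    IsExtremal z A l lam G ↔ G = kernelSum z (coef z A l lam) := by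
  have hK := memHardy_kernelSum z (coef z A l lam)
  have hadd : ∀ G, MemHardy G → tikhonov z A l lam G =
      tikhonov z A l lam (kernelSum z (coef z A l lam)) +
        lam * hardyNorm (G - kernelSum z (coef z A l lam)) ^ 2 +
        ∑ j, l j * ((G - kernelSum z (coef z A l lam)) (z j)).re ^ 2 := by
    intro G hG
    rw [← tikhonov_add z A l hl hlam (hG.sub hK), sub_add_cancel]
  have hsum : ∀ H : ℍ → ℂ, 0 ≤ ∑ j, l j * (H (z j)).re ^ 2 := fun H =>
    Finset.sum_nonneg fun j _ => mul_nonneg (hl j).le (sq_nonneg _)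
  constructor
  · rintro ⟨hG, hmin⟩
    have h1 := hmin _ hK
    rw [hadd G hG] at h1
    have h2 := hsum (G - kernelSum z (coef z A l lam))
    have h3 : lam * hardyNorm (G - kernelSum z (coef z A l lam)) ^ 2 = 0 :=
      le_antisymm (by linarith) (by positivity)
    have h4 : hardyNorm (G - kernelSum z (coef z A l lam)) = 0 := by
      simpa [hlam.ne'] using h3
    exact sub_eq_zero.1 ((hG.sub hK).eq_zero_of_hardyNorm_eq_zero h4)
  · rintro rfl
    refine ⟨hK, fun G hG => ?_⟩
    rw [hadd G hG]
    have h2 := hsum (G - kernelSum z (coef z A l lam))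
    have h3 : 0 ≤ lam * hardyNorm (G - kernelSum z (coef z A l lam)) ^ 2 := by positivity
    linarith

end Iteration

/-! ### Invertibility of the Gram matrix and the limit λ → 0⁺. -/

section Gram

variable {ι : Type*} [Fintype ι]

/-- Szegő kernels with distinct poles are linearly independent. -/
lemma eq_zero_of_kernelSum_eq_zero {p : ι → ℍ} (hp : Function.Injective p) {c : ι → ℝ}
    (h : kernelSum p c = 0) : c = 0 := by
  classical
  set q : ι → ℂ := fun i => (starRingEnd ℂ) (p i : ℂ) with hq
  have hqi : Function.Injective q := fun i j e =>
    hp (UpperHalfPlane.ext ((starRingEnd ℂ).injective e))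
  -- The kernel combination with denominators cleared, up to a constant. It vanishes on the
  -- half-plane, hence identically, and its value at the pole `q k` isolates `c k`.
  set P : Polynomial ℂ := ∑ i, Polynomial.C (c i : ℂ) *
    ∏ j ∈ Finset.univ.erase i, (Polynomial.X - Polynomial.C (q j)) with hP
  have heval : ∀ w : ℂ, P.eval w = ∑ i, (c i : ℂ) * ∏ j ∈ Finset.univ.erase i, (w - q j) := by
    intro w
    simp [hP, Polynomial.eval_finsetSum, Polynomial.eval_prod]
  have hroot : ∀ w : ℍ, P.eval (w : ℂ) = 0 := by
    intro w
    have hne : ∀ i, (w : ℂ) - q i ≠ 0 := fun i => sub_conj_ne_zero w.im_pos (p i)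
    have h1 : ∑ i, (c i : ℂ) * szego w (p i) = 0 := by
      rw [← kernelSum_apply, h]
      rfl
    have h2 : Complex.I / (2 * Real.pi) * ∑ i, (c i : ℂ) * ((w : ℂ) - q i)⁻¹ = 0 := by
      rw [← h1, Finset.mul_sum]
      refine Finset.sum_congr rfl fun i _ => ?_
      rw [szego_eq]
      ring
    have h3 : ∑ i, (c i : ℂ) * ((w : ℂ) - q i)⁻¹ = 0 := by
      refine (mul_eq_zero.1 h2).resolve_left ?_
      simp [Real.pi_ne_zero]
    have h4 : P.eval (w : ℂ) = (∏ j, ((w : ℂ) - q j)) * ∑ i, (c i : ℂ) * ((w : ℂ) - q i)⁻¹ := by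
      rw [heval, Finset.mul_sum]
      refine Finset.sum_congr rfl fun i _ => ?_
      rw [← Finset.mul_prod_erase _ _ (Finset.mem_univ i)]
      have := hne i
      field_simp
    rw [h4, h3, mul_zero]
  have hP0 : P = 0 := by
    refine Polynomial.eq_zero_of_infinite_isRoot P ?_
    refine Set.Infinite.mono (s := Set.range fun n : ℕ => ((n : ℂ) + Complex.I)) ?_ ?_
    · rintro _ ⟨n, rfl⟩
      exact hroot ⟨(n : ℂ) + Complex.I, by simp⟩
    · exact Set.infinite_range_of_injective fun m n e => by simpa using e
  funext k
  have h5 := heval (q k)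
  rw [hP0, Polynomial.eval_zero, Finset.sum_eq_single k] at h5
  · have h6 : ∏ j ∈ Finset.univ.erase k, (q k - q j) ≠ 0 := by
      refine Finset.prod_ne_zero_iff.2 fun j hj => sub_ne_zero.2 fun e => ?_
      exact (Finset.ne_of_mem_erase hj) (hqi e).symm
    have := (mul_eq_zero.1 h5.symm).resolve_right h6
    exact_mod_cast this
  · intro i _ hik
    rw [Finset.prod_eq_zero (Finset.mem_erase.2 ⟨hik.symm, Finset.mem_univ k⟩) (sub_self _),
      mul_zero]
  · simp

/-- The real Gram matrix of the Szegő kernels at the points `p_i`. -/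
def gram (p : ι → ℍ) : Matrix ι ι ℝ :=
  Matrix.of fun i j => (szego (p i) (p j)).re

lemma gram_mulVec_apply (p : ι → ℍ) (c : ι → ℝ) (i : ι) :
    (gram p *ᵥ c) i = (kernelSum p c (p i)).re := by
  rw [kernelSum_re]
  exact Finset.sum_congr rfl fun j _ => mul_comm _ _

lemma det_gram_ne_zero [DecidableEq ι] {p : ι → ℍ} (hp : Function.Injective p) :
    (gram p).det ≠ 0 := by
  intro h
  obtain ⟨v, hv, hv0⟩ := Matrix.exists_mulVec_eq_zero_iff.2 h
  have h1 : hardyNorm (kernelSum p v) ^ 2 = 0 := by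
    rw [hardyNorm_kernelSum]
    refine Finset.sum_eq_zero fun i _ => ?_
    have : (gram p *ᵥ v) i = 0 := by rw [hv0]; rfl
    have e : ∑ j, v i * v j * (szego (p i) (p j)).re = v i * (gram p *ᵥ v) i := by
      rw [Matrix.mulVec, dotProduct, Finset.mul_sum]
      exact Finset.sum_congr rfl fun j _ => by rw [gram, Matrix.of_apply]; ring
    rw [e, this, mul_zero]
  exact hv (eq_zero_of_kernelSum_eq_zero hp
    ((memHardy_kernelSum p v).eq_zero_of_hardyNorm_eq_zero (by simpa using h1)))

/-- The coefficients of the minimal interpolant of the values `a_i` at the points `p_i`. -/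
def interpCoef [DecidableEq ι] (p : ι → ℍ) (a : ι → ℝ) : ι → ℝ :=
  (gram p)⁻¹ *ᵥ a

lemma kernelSum_interpCoef_re [DecidableEq ι] {p : ι → ℍ} (hp : Function.Injective p) (a : ι → ℝ)
    (i : ι) : (kernelSum p (interpCoef p a) (p i)).re = a i := by
  rw [← gram_mulVec_apply, interpCoef, Matrix.mulVec_mulVec,
    Matrix.mul_nonsing_inv _ (isUnit_iff_ne_zero.2 (det_gram_ne_zero hp)), Matrix.one_mulVec]

/-- The hypothesis says (λW⁻¹ + G)C = a. Matrix inversion is continuous at the invertible matrix G.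
-/
lemma tendsto_of_regularized [DecidableEq ι] {p : ι → ℍ} (hp : Function.Injective p) (a : ι → ℝ)
    {W : ι → ℝ} (hW : ∀ i, 0 < W i) {C : ℝ → ι → ℝ}
    (hC : ∀ lam, 0 < lam → ∀ i, lam * C lam i = W i * (a i - (kernelSum p (C lam) (p i)).re)) :
    Tendsto C (𝓝[>] 0) (𝓝 (interpCoef p a)) := by
  set B : ℝ → Matrix ι ι ℝ := fun lam => lam • Matrix.diagonal (fun i => (W i)⁻¹) + gram p with hB
  have hBc : Continuous B := by fun_prop
  have hB0 : B 0 = gram p := by simp [hB]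
  have hdet := det_gram_ne_zero hp
  have hinv : ContinuousAt (fun lam => (B lam)⁻¹ *ᵥ a) 0 := by
    have h1 : ContinuousAt (fun M : Matrix ι ι ℝ => M⁻¹) (B 0) := by
      refine continuousAt_matrix_inv _ ?_
      rw [Ring.inverse_eq_inv']
      exact continuousAt_inv₀ (by rwa [hB0])
    have h2 : Continuous fun M : Matrix ι ι ℝ => M *ᵥ a := by fun_prop
    exact h2.continuousAt.comp (h1.comp hBc.continuousAt)
  have hlim : Tendsto (fun lam => (B lam)⁻¹ *ᵥ a) (𝓝[>] 0) (𝓝 (interpCoef p a)) := by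
    have := hinv.tendsto.mono_left (nhdsWithin_le_nhds (s := Set.Ioi 0))
    rwa [hB0] at this
  refine hlim.congr' ?_
  have hev : ∀ᶠ lam in 𝓝[>] (0 : ℝ), (B lam).det ≠ 0 :=
    (hBc.matrix_det.continuousAt.eventually_ne (by rwa [hB0])).filter_mono nhdsWithin_le_nhds
  filter_upwards [hev, self_mem_nhdsWithin] with lam hd hlam
  have : a = B lam *ᵥ C lam := by
    funext i
    have h := hC lam hlam i
    simp only [hB, Matrix.add_mulVec, Matrix.smul_mulVec, Pi.add_apply, Pi.smul_apply,
      Matrix.mulVec_diagonal, gram_mulVec_apply, smul_eq_mul]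
    have hw := (hW i).ne'
    field_simp
    linear_combination -h
  rw [this, Matrix.mulVec_mulVec, Matrix.nonsing_inv_mul _ (isUnit_iff_ne_zero.2 hd),
    Matrix.one_mulVec]

lemma tendsto_hardyNorm_kernelSum {p : ι → ℍ} {C : ℝ → ι → ℝ} {d : ι → ℝ} {f : Filter ℝ}
    (hC : Tendsto C f (𝓝 d)) :
    Tendsto (fun lam => hardyNorm (kernelSum p (C lam) - kernelSum p d)) f (𝓝 0) := by
  have h1 : ∀ lam, hardyNorm (kernelSum p (C lam) - kernelSum p d) =
      Real.sqrt (∑ i, ∑ j, (C lam - d) i * (C lam - d) j * (szego (p i) (p j)).re) := by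
    intro lam
    rw [kernelSum_sub, ← hardyNorm_kernelSum]
    exact (Real.sqrt_sq ENNReal.toReal_nonneg).symm
  simp_rw [h1]
  have h2 : Continuous fun v : ι → ℝ =>
      Real.sqrt (∑ i, ∑ j, (v - d) i * (v - d) j * (szego (p i) (p j)).re) := by
    simp only [Pi.sub_apply]
    fun_prop
  have h3 := (h2.tendsto d).comp hC
  simpa [Function.comp_def] using h3

lemma tendstoUniformlyOn_kernelSum {p : ι → ℍ} {C : ℝ → ι → ℝ} {d : ι → ℝ} {f : Filter ℝ}
    (hC : Tendsto C f (𝓝 d)) {E : Set ℍ} (hE : BddAbove ((fun w : ℍ => (szego w w).re) '' E)) :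
    TendstoUniformlyOn (fun lam w => (kernelSum p (C lam) w).re)
      (fun w => (kernelSum p d w).re) f E := by
  obtain ⟨b, hb⟩ := hE
  have hlim : Tendsto (fun lam => ∑ i, |C lam i - d i| * (b + (szego (p i) (p i)).re)) f (𝓝 0) := by
    have h2 : Continuous fun v : ι → ℝ =>
        ∑ i, |v i - d i| * (b + (szego (p i) (p i)).re) := by fun_prop
    have h3 := (h2.tendsto d).comp hC
    simpa [Function.comp_def] using h3
  rw [Metric.tendstoUniformlyOn_iff]
  intro ε hε
  filter_upwards [hlim.eventually_lt_const hε] with lam hlt w hw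
  refine lt_of_le_of_lt ?_ hlt
  rw [dist_comm, Real.dist_eq, ← Complex.sub_re, ← Pi.sub_apply, kernelSum_sub, kernelSum_re]
  refine (Finset.abs_sum_le_sum_abs _ _).trans (Finset.sum_le_sum fun i _ => ?_)
  rw [abs_mul, Pi.sub_apply]
  gcongr
  exact (abs_szego_re_le w (p i)).trans (add_le_add_left (hb ⟨w, hw, rfl⟩) _)

end Gram

/-! ### Merging coinciding points; least squares and the Moore–Penrose solution. -/

section LeastSquares

open scoped Classical

variable {N : ℕ} (z : Fin N → ℍ) (A l : Fin N → ℝ)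

/-- The sum of the weights attached to a point. -/
def pointWeight (s : Set.range z) : ℝ :=
  ∑ j with Set.rangeFactorization z j = s, l j

/-- The weighted mean of the data attached to a point. -/
def pointMean (s : Set.range z) : ℝ :=
    (∑ j with Set.rangeFactorization z j = s, l j * A j) / pointWeight z l s

variable {l}

lemma pointWeight_pos (hl : ∀ j, 0 < l j) (s : Set.range z) : 0 < pointWeight z l s := by
  obtain ⟨j, hj⟩ := Set.rangeFactorization_surjective s
  exact Finset.sum_pos (fun j _ => hl j) ⟨j, by simpa using hj⟩

lemma sum_mul_sub_pointMean (hl : ∀ j, 0 < l j) (s : Set.range z) :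
    ∑ j with Set.rangeFactorization z j = s, l j * (A j - pointMean z A l s) = 0 := by
  have h := (pointWeight_pos z hl s).ne'
  have h1 : pointMean z A l s * pointWeight z l s =
      ∑ j with Set.rangeFactorization z j = s, l j * A j := by
    rw [pointMean, div_mul_cancel₀ _ h]
  simp_rw [mul_sub, Finset.sum_sub_distrib, ← Finset.sum_mul]
  rw [← h1, mul_comm, pointWeight, sub_self]

lemma pointMean_eq (hl : ∀ j, 0 < l j) (hA : ∀ i j, z i = z j → A i = A j) (j : Fin N) :
    pointMean z A l (Set.rangeFactorization z j) = A j := by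
  have h := (pointWeight_pos z hl (Set.rangeFactorization z j)).ne'
  rw [pointMean, div_eq_iff h, pointWeight, Finset.mul_sum]
  refine Finset.sum_congr rfl fun i hi => ?_
  have : z i = z j := congrArg Subtype.val (Finset.mem_filter.1 hi).2
  rw [hA i j this, mul_comm]

/-- Split into the spread of the data about their means, which does not depend on F, and the misfit
to the means. The cross terms cancel over each group of coinciding points. -/
lemma residual_eq (hl : ∀ j, 0 < l j) (F : ℍ → ℂ) :
    residual z A l F =
      ∑ j, l j * (A j - pointMean z A l (Set.rangeFactorization z j)) ^ 2 +
        ∑ j, l j * ((F (z j)).re - pointMean z A l (Set.rangeFactorization z j)) ^ 2 := by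
  have hcross : ∑ j, l j * (A j - pointMean z A l (Set.rangeFactorization z j)) *
      ((F (z j)).re - pointMean z A l (Set.rangeFactorization z j)) = 0 := by
    rw [← Finset.sum_fiberwise (s := Finset.univ) (g := Set.rangeFactorization z)]
    refine Finset.sum_eq_zero fun s _ => ?_
    have : ∀ j ∈ Finset.univ.filter (fun j => Set.rangeFactorization z j = s),
        l j * (A j - pointMean z A l (Set.rangeFactorization z j)) *
          ((F (z j)).re - pointMean z A l (Set.rangeFactorization z j)) =
        l j * (A j - pointMean z A l s) * ((F s).re - pointMean z A l s) := by
      intro j hj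
      obtain rfl := (Finset.mem_filter.1 hj).2
      rfl
    rw [Finset.sum_congr rfl this, ← Finset.sum_mul, sum_mul_sub_pointMean z A hl, zero_mul]
  have h : ∀ j, l j * |(F (z j)).re - A j| ^ 2 =
      l j * (A j - pointMean z A l (Set.rangeFactorization z j)) ^ 2 +
        l j * ((F (z j)).re - pointMean z A l (Set.rangeFactorization z j)) ^ 2 -
        2 * (l j * (A j - pointMean z A l (Set.rangeFactorization z j)) *
          ((F (z j)).re - pointMean z A l (Set.rangeFactorization z j))) := by
    intro j
    rw [sq_abs]
    ring
  unfold residual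
  simp_rw [h, Finset.sum_sub_distrib, Finset.sum_add_distrib, ← Finset.mul_sum]
  rw [hcross]
  ring

variable (l) in
/-- The Moore–Penrose solution: the minimal interpolant of the mean data. -/
def minimalSolution : ℍ → ℂ :=
  kernelSum (fun s : Set.range z => (s : ℍ))
    (interpCoef (fun s : Set.range z => (s : ℍ)) (pointMean z A l))

lemma memHardy_minimalSolution : MemHardy (minimalSolution z A l) :=
  memHardy_kernelSum _ _

lemma minimalSolution_re (s : Set.range z) :
    (minimalSolution z A l s).re = pointMean z A l s := by
  exact kernelSum_interpCoef_re Subtype.val_injective _ s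

lemma isLeastSquares_iff (hl : ∀ j, 0 < l j) (G : ℍ → ℂ) :
    IsLeastSquares z A l G ↔ MemHardy G ∧ ∀ s : Set.range z, (G s).re = pointMean z A l s := by
  have hval : ∀ F : ℍ → ℂ, (∀ s : Set.range z, (F s).re = pointMean z A l s) →
      ∑ j, l j * ((F (z j)).re - pointMean z A l (Set.rangeFactorization z j)) ^ 2 = 0 := by
    intro F hF
    refine Finset.sum_eq_zero fun j _ => ?_
    have : (F (z j)).re = pointMean z A l (Set.rangeFactorization z j) :=
      hF (Set.rangeFactorization z j)
    rw [this]
    ring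
  have hnn : ∀ F : ℍ → ℂ, ∀ j ∈ Finset.univ,
      0 ≤ l j * ((F (z j)).re - pointMean z A l (Set.rangeFactorization z j)) ^ 2 :=
    fun F j _ => mul_nonneg (hl j).le (sq_nonneg _)
  constructor
  · rintro ⟨hG, hmin⟩
    refine ⟨hG, fun s => ?_⟩
    have h1 := hmin _ (memHardy_minimalSolution z A (l := l))
    rw [residual_eq z A hl, residual_eq z A hl, hval _ (minimalSolution_re z A)] at h1
    have h2 := le_antisymm (by linarith) (Finset.sum_nonneg (hnn G))
    obtain ⟨j, rfl⟩ := Set.rangeFactorization_surjective s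
    have h3 := (Finset.sum_eq_zero_iff_of_nonneg (hnn G)).1 h2 j (Finset.mem_univ j)
    have h4 := (mul_eq_zero.1 h3).resolve_left (hl j).ne'
    exact sub_eq_zero.1 (pow_eq_zero_iff two_ne_zero |>.1 h4)
  · rintro ⟨hG, hs⟩
    refine ⟨hG, fun F _ => ?_⟩
    rw [residual_eq z A hl, residual_eq z A hl, hval _ hs]
    have := Finset.sum_nonneg (hnn F)
    linarith

/-- The real part of the difference of two least-squares solutions vanishes at every point, so the
difference is orthogonal to the kernels spanning the minimal one. -/
lemma hardyNorm_sq_of_isLeastSquares (hl : ∀ j, 0 < l j) {G : ℍ → ℂ}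
    (hG : IsLeastSquares z A l G) :
    hardyNorm G ^ 2 = hardyNorm (G - minimalSolution z A l) ^ 2 +
      hardyNorm (minimalSolution z A l) ^ 2 := by
  obtain ⟨hGm, hGs⟩ := (isLeastSquares_iff z A hl G).1 hG
  have h := (hGm.sub (memHardy_minimalSolution z A (l := l))).hardyNorm_add_kernelSum
    (fun s : Set.range z => (s : ℍ))
    (interpCoef (fun s : Set.range z => (s : ℍ)) (pointMean z A l))
  have h0 : ∀ s : Set.range z, ((G - minimalSolution z A l) s).re = 0 := by
    intro s
    rw [Pi.sub_apply, Complex.sub_re, hGs, minimalSolution_re, sub_self]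
  simp_rw [h0, mul_zero, Finset.sum_const_zero, mul_zero, add_zero] at h
  have e : hardyNorm G = hardyNorm (G - minimalSolution z A l + minimalSolution z A l) := by
    rw [sub_add_cancel]
  rw [e]
  exact h

lemma isLeastSquares_minimalSolution (hl : ∀ j, 0 < l j) :
    IsLeastSquares z A l (minimalSolution z A l) :=
  (isLeastSquares_iff z A hl _).2 ⟨memHardy_minimalSolution z A, minimalSolution_re z A⟩

lemma isMoorePenrose_iff (hl : ∀ j, 0 < l j) (G : ℍ → ℂ) :
    IsMoorePenrose z A l G ↔ G = minimalSolution z A l := by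
  constructor
  · rintro ⟨hG, hmin⟩
    have h1 := hmin _ (isLeastSquares_minimalSolution z A hl)
    have h2 := hardyNorm_sq_of_isLeastSquares z A hl hG
    have h3 : hardyNorm G ^ 2 ≤ hardyNorm (minimalSolution z A l) ^ 2 :=
      pow_le_pow_left₀ ENNReal.toReal_nonneg h1 2
    have h4 : hardyNorm (G - minimalSolution z A l) ^ 2 = 0 :=
      le_antisymm (by linarith) (sq_nonneg _)
    exact sub_eq_zero.1 ((hG.1.sub (memHardy_minimalSolution z A)).eq_zero_of_hardyNorm_eq_zero
      (pow_eq_zero_iff two_ne_zero |>.1 h4))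
  · rintro rfl
    refine ⟨isLeastSquares_minimalSolution z A hl, fun G hG => ?_⟩
    refine le_of_sq_le_sq ?_ ENNReal.toReal_nonneg
    rw [hardyNorm_sq_of_isLeastSquares z A hl hG]
    exact le_add_of_nonneg_left (sq_nonneg _)

variable (l) in
/-- The coefficients of the regularized solution, collected at the distinct points. -/
def pointCoef (lam : ℝ) (s : Set.range z) : ℝ :=
  ∑ j with Set.rangeFactorization z j = s, coef z A l lam j

lemma kernelSum_pointCoef (lam : ℝ) :
    kernelSum (fun s : Set.range z => (s : ℍ)) (pointCoef z A l lam) =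
      kernelSum z (coef z A l lam) := by
  funext w
  rw [kernelSum_apply, kernelSum_apply,
    ← Finset.sum_fiberwise (s := Finset.univ) (g := Set.rangeFactorization z)]
  refine Finset.sum_congr rfl fun s _ => ?_
  rw [pointCoef, Complex.ofReal_sum, Finset.sum_mul]
  refine Finset.sum_congr rfl fun j hj => ?_
  obtain rfl := (Finset.mem_filter.1 hj).2
  rfl

/-- The normal equations summed over coinciding points. The sum is needed: with inconsistent data,
λc_j tends to λ_j(A_j − mean), so individual coefficients can blow up while their sums converge. -/
lemma lam_mul_pointCoef (hl : ∀ j, 0 < l j) {lam : ℝ} (hlam : 0 < lam) (s : Set.range z) :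
    lam * pointCoef z A l lam s = pointWeight z l s * (pointMean z A l s -
      (kernelSum (fun s : Set.range z => (s : ℍ)) (pointCoef z A l lam) s).re) := by
  rw [kernelSum_pointCoef, kernelSum_coef_re, pointCoef, Finset.mul_sum]
  have : ∀ j ∈ Finset.univ.filter (fun j => Set.rangeFactorization z j = s),
      lam * coef z A l lam j = l j * (A j - pointMean z A l s) +
        l j * (pointMean z A l s - approxSolution z A l lam s) := by
    intro j hj
    obtain rfl := (Finset.mem_filter.1 hj).2
    rw [lam_mul_coef z A l hl hlam]
    simp only [Set.rangeFactorization_coe]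
    ring
  rw [Finset.sum_congr rfl this, Finset.sum_add_distrib, sum_mul_sub_pointMean z A hl, zero_add,
    ← Finset.sum_mul, pointWeight]

lemma tendsto_pointCoef (hl : ∀ j, 0 < l j) :
    Tendsto (pointCoef z A l) (𝓝[>] 0)
      (𝓝 (interpCoef (fun s : Set.range z => (s : ℍ)) (pointMean z A l))) :=
  tendsto_of_regularized Subtype.val_injective _ (pointWeight_pos z hl)
    fun _ hlam s => lam_mul_pointCoef z A hl hlam s

lemma tendstoUniformlyOn_approxSolution (hl : ∀ j, 0 < l j) {E : Set ℍ}
    (hE : BddAbove ((fun w : ℍ => (szego w w).re) '' E)) :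
    TendstoUniformlyOn (fun lam : ℝ => approxSolution z A l lam)
      (fun w => (minimalSolution z A l w).re) (𝓝[>] 0) E := by
  have := tendstoUniformlyOn_kernelSum (p := fun s : Set.range z => (s : ℍ))
    (tendsto_pointCoef z A hl) hE
  simp_rw [kernelSum_pointCoef, kernelSum_coef_re] at this
  exact this

lemma tendsto_hardyNorm_approxAnalytic (hl : ∀ j, 0 < l j) :
    Tendsto (fun lam : ℝ => hardyNorm (approxAnalytic z A l lam - minimalSolution z A l))
      (𝓝[>] 0) (𝓝 0) := by
  have := tendsto_hardyNorm_kernelSum (p := fun s : Set.range z => (s : ℍ))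
    (tendsto_pointCoef z A hl)
  simp_rw [kernelSum_pointCoef, ← approxAnalytic_eq] at this
  exact this

lemma MemHardy.harmonicOnNhd_re {F : ℍ → ℂ} (hF : MemHardy F) :
    InnerProductSpace.HarmonicOnNhd
      (fun w : ℂ => (F (UpperHalfPlane.ofComplex w)).re) {w : ℂ | 0 < w.im} := fun _ hw =>
  AnalyticAt.harmonicAt_re (hF.1.analyticAt
    ((isOpen_lt continuous_const Complex.continuous_im).mem_nhds hw))

end LeastSquares

end HardyDirichlet

end

theorem theorem2 {N : ℕ} (z : Fin N → ℍ) (A l : Fin N → ℝ) (hl : ∀ j, 0 < l j) :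
    -- the function given by the algorithm solves the regularized extremal problem
    (∀ lam : ℝ, 0 < lam →
      (∀ w : ℍ, HardyDirichlet.approxSolution z A l lam w =
        ∑ j, A j * l j * (HardyDirichlet.iterKernel z l lam (Fin.last N) w (z j)).re) ∧
      ∃ F : ℍ → ℂ, HardyDirichlet.IsExtremal z A l lam F ∧
        (∀ G : ℍ → ℂ, HardyDirichlet.IsExtremal z A l lam G → G = F) ∧
        (∀ w : ℍ, (F w).re = HardyDirichlet.approxSolution z A l lam w) ∧
        F = HardyDirichlet.approxAnalytic z A l lam) ∧
    -- as `lam → 0`, it converges to the Moore–Penrose solution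
    ∃ F : ℍ → ℂ, HardyDirichlet.IsMoorePenrose z A l F ∧
      (∀ G : ℍ → ℂ, HardyDirichlet.IsMoorePenrose z A l G → G = F) ∧
      (∀ w : ℍ, Tendsto (fun lam : ℝ => HardyDirichlet.approxSolution z A l lam w)
        (𝓝[>] 0) (𝓝 (F w).re)) ∧
      (∀ E : Set ℍ, BddAbove ((fun p : ℍ => (HardyDirichlet.szego p p).re) '' E) →
        TendstoUniformlyOn (fun lam : ℝ => HardyDirichlet.approxSolution z A l lam)
          (fun w : ℍ => (F w).re) (𝓝[>] 0) E) ∧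
      Tendsto (fun lam : ℝ => HardyDirichlet.hardyNorm
        (HardyDirichlet.approxAnalytic z A l lam - F)) (𝓝[>] 0) (𝓝 0) ∧
      -- whose real part solves the discrete Dirichlet problem
      InnerProductSpace.HarmonicOnNhd
        (fun w : ℂ => (F (UpperHalfPlane.ofComplex w)).re) {w : ℂ | 0 < w.im} ∧
      ((∀ i j, z i = z j → A i = A j) → ∀ j, (F (z j)).re = A j) := by
  open HardyDirichlet in
  refine ⟨fun lam hlam => ⟨approxSolution_eq_sum z A l, approxAnalytic z A l lam, ?_, ?_, ?_, rfl⟩,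
    minimalSolution z A l, (isMoorePenrose_iff z A hl _).2 rfl,
    fun G hG => (isMoorePenrose_iff z A hl G).1 hG, fun w => ?_,
    fun E hE => tendstoUniformlyOn_approxSolution z A hl hE,
    tendsto_hardyNorm_approxAnalytic z A hl, (memHardy_minimalSolution z A).harmonicOnNhd_re,
    fun hA j => ?_⟩
  · rw [approxAnalytic_eq]
    exact (isExtremal_iff z A l hl hlam _).2 rfl
  · intro G hG
    rw [approxAnalytic_eq]
    exact (isExtremal_iff z A l hl hlam G).1 hG
  · intro w
    rw [approxAnalytic_eq, kernelSum_coef_re]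
  · refine (tendstoUniformlyOn_approxSolution z A hl (E := {w}) ?_).tendsto_at rfl
    rw [Set.image_singleton]
    exact bddAbove_singleton
  · exact (minimalSolution_re z A (Set.rangeFactorization z j)).trans (pointMean_eq z A hl hA j)
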